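/- **Definitions.** Banach spaces are real and $L^p(S)=L^p(S,\mathcal S,\mu;\mathbb R)$. A *Rademacher family* is a sequence $(r_j)_{j\in\mathbb N}$ of independent random variables on a complete probability space with values in $\{-1,1\}$, each value having probability $\tfrac12$. For $q\in[1,\infty)$ the Khintchine constant $B_q\in(0,\infty)$ is the smallest positive constant such that $\|\sum_{j=1}^n r_ja_j\|_{L^q}\le B_q(\sum_{j=1}^n a_j^2)^{1/2}$ for every Rademacher family and every finite sequence $(a_j)_{j=1}^n$ of reals. For $p,q\in[1,\infty)$ the Kahane–Khintchine constant $K_{q,p}\in(0,\infty)$ is the smallest positive constant such that $\|\sum_{j=1}^n r_jx_j\|_{L^q(E)}\le K_{q,p}\|\sum_{j=1}^n r_jx_j\|_{L^p(E)}$ for every Rademacher family, every Banach space $E$, every $n\in\mathbb N$ and all $x_1,\dots,x_n\in E$. A $\sigma$-finite measure space $(S,\mathcal S,\mu)$ has the *approximation-by-averaging property* if for every $n\in\mathbb N$ there is an at most countable family $(B^n_k)_{k\in\mathcal K_n}$ of pairwise disjoint sets in $\mathcal S$ with $\mu(B^n_k)\in(0,\infty)$ such that, for every Banach space $E$, every $p\in[1,\infty)$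 and every $f\in L^p(S;E)$, the functions $f_n:=\sum_{k\in\mathcal K_n}\mathbf 1_{B^n_k}\,\mu(B^n_k)^{-1}\int_{B^n_k}f\,\mathrm d\mu$ converge to $f$ in $L^p(S;E)$ as $n\to\infty$ (the families not depending on $E$, $p$, $f$). Let $(\Omega,\mathcal A,\mathbb P)$ be a probability space. A random variable $\eta\in L^q(\Omega;L^p(S))$ has an essentially unique $\mathcal S\otimes\mathcal A$-measurable version $\widetilde\eta:S\times\Omega\to\mathbb R$ with $\eta(\omega)=\widetilde\eta(\cdot,\omega)$ in $L^p(S)$ for $\mathbb P$-almost all $\omega$. We say $\eta\in L^p(S;L^q(\Omega))$ if $s\mapsto\widetilde\eta(s,\cdot)$ belongs to that Bochner space, and denote the norm of this map by $\|\eta\|_{L^p(S;L^q(\Omega))}$. **Statement.** Let $(S,\mathcal S,\mu)$ be a $\sigma$-finite measure space with the approximation-by-averaging property. (i) Let $p,q\in[1,\infty)$, $\bar q:=\min\{q,2\}$, $M\in\{1,2,\dots\}$, and let $X_1,\dots,X_M\in L^q(\Omega;L^p(S))\cap L^p(S;L^q(\Omega))$ be independent and identically distributed $L^p(S)$-valued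 random variables. Then, for every $U\in L^p(S)$, $$\Bigl\|U-\frac1M\sum_{j=1}^M X_j\Bigr\|_{L^q(\Omega;L^p(S))}\le\|U-\mathbb E[X_1]\|_{L^p(S)}+M^{-(1-1/\bar q)}\,C_{SL,q,p}(X_1),$$ where $$C_{SL,q,p}(X_1):=\begin{cases}2K_{q,\bar q}\,B_p\,\|X_1-\mathbb E[X_1]\|_{L^q(\Omega;L^p(S))}&\text{if }q\in[1,p),\\[2pt]2B_q\,\|X_1-\mathbb E[X_1]\|_{L^p(S;L^q(\Omega))}&\text{if }q\in[p,\infty).\end{cases}$$ (ii) In particular, let $q\in(1,\infty)$ and let $(X_j)_{j\ge1}$ be a sequence of independent and identically distributed $L^1(S)$-valued random variables in $L^q(\Omega;L^1(S))\cap L^1(S;L^q(\Omega))$. Then $$\lim_{M\to\infty}\Bigl\|\mathbb E[X_1]-\frac1M\sum_{j=1}^M X_j\Bigr\|_{L^q(\Omega;L^1(S))}=0.$$ -/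

import Mathlib

open MeasureTheory ProbabilityTheory Filter Topology
open scoped ENNReal

universe u v

noncomputable section

/-- A sequence of independent random variables with values in `{-1, 1}`, both values being taken
with probability `1/2`. -/
structure IsRademacherFamily {Ω : Type} [MeasurableSpace Ω] (P : Measure Ω) (r : ℕ → Ω → ℝ) :
    Prop where
  measurable : ∀ j, Measurable (r j)
  values : ∀ j ω, r j ω = -1 ∨ r j ω = 1
  prob_neg_one : ∀ j, P {ω | r j ω = -1} = 1 / 2
  prob_one : ∀ j, P {ω | r j ω = 1} = 1 / 2
  indep : iIndepFun r P

/-- The (upper) Khintchine constant `B_q`: the smallest positive real `B` with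
`‖∑ r_j a_j‖_{L^q} ≤ B (∑ a_j²)^{1/2}` for all Rademacher families on complete probability
spaces and all finite sequences of reals. -/
def khintchineB (q : ℝ≥0∞) : ℝ :=
  sInf {B : ℝ | 0 < B ∧
    ∀ (Ω : Type) [MeasurableSpace Ω] (P : Measure Ω) [IsProbabilityMeasure P] [P.IsComplete]
      (r : ℕ → Ω → ℝ), IsRademacherFamily P r →
      ∀ (n : ℕ) (a : ℕ → ℝ),
        eLpNorm (fun ω => ∑ j ∈ Finset.range n, r j ω * a j) q P
          ≤ ENNReal.ofReal (B * Real.sqrt (∑ j ∈ Finset.range n, a j ^ 2))}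

/-- The Kahane–Khintchine constant `K_{q,p}`: the smallest positive real `K` with
`‖∑ r_j x_j‖_{L^q(E)} ≤ K ‖∑ r_j x_j‖_{L^p(E)}` for all Rademacher families on complete
probability spaces, all real Banach spaces `E` and all finite sequences in `E`. (The inequality
only involves the finite-dimensional span of the `x_j`, so the universe of `E` is immaterial.) -/
def kahaneKhintchineK (q p : ℝ≥0∞) : ℝ :=
  sInf {K : ℝ | 0 < K ∧
    ∀ (Ω : Type) [MeasurableSpace Ω] (P : Measure Ω) [IsProbabilityMeasure P] [P.IsComplete]
      (r : ℕ → Ω → ℝ), IsRademacherFamily P r →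
      ∀ (E : Type u) [NormedAddCommGroup E] [NormedSpace ℝ E] [CompleteSpace E]
        (n : ℕ) (x : ℕ → E),
        eLpNorm (fun ω => ∑ j ∈ Finset.range n, r j ω • x j) q P
          ≤ ENNReal.ofReal K * eLpNorm (fun ω => ∑ j ∈ Finset.range n, r j ω • x j) p P}

/-- The function obtained from `f` by averaging over each set `B k`, `k ∈ I`:
`∑_{k ∈ I} 1_{B k} · (1/μ(B k)) ∫_{B k} f dμ`. For pairwise disjoint `B k` at most one term is
nonzero at each point. -/
def averageOver {S : Type u} [MeasurableSpace S] (μ : Measure S)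
    {E : Type v} [NormedAddCommGroup E] [NormedSpace ℝ E]
    (I : Set ℕ) (B : ℕ → Set S) (f : S → E) (s : S) : E :=
  ∑' k : I, (B k).indicator (fun _ => ⨍ x in B k, f x ∂μ) s

/-- The approximation-by-averaging property of a measure space. The families `(B n k)_{k ∈ I n}`
are chosen before the Banach space, the exponent and the function. (Elements of `L^p(S;E)` are
a.e. separably valued, so the universe of `E` is immaterial.) -/
def ApproximationByAveraging {S : Type u} [MeasurableSpace S] (μ : Measure S) : Prop :=
  ∃ (I : ℕ → Set ℕ) (B : ℕ → ℕ → Set S),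
    (∀ n, ∀ k ∈ I n, MeasurableSet (B n k) ∧ 0 < μ (B n k) ∧ μ (B n k) < ∞) ∧
    (∀ n, (I n).PairwiseDisjoint (B n)) ∧
    ∀ (E : Type v) [NormedAddCommGroup E] [NormedSpace ℝ E] [CompleteSpace E] (p : ℝ≥0∞),
      1 ≤ p → p ≠ ∞ → ∀ f : S → E, MemLp f p μ →
        Tendsto (fun n => eLpNorm (fun s => f s - averageOver μ (I n) (B n) f s) p μ)
          atTop (𝓝 0)

section Mixed

variable {S : Type u} {Ω : Type v} [MeasurableSpace S] [MeasurableSpace Ω]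

/-- `F : S → L^q(Ω)` is the map `s ↦ η(s, ·)` belonging to the random variable
`η : Ω → L^p(S)`: there is a function `g` on `S × Ω`, measurable for the product σ-algebra, with
`η ω = g(·, ω)` in `L^p(S)` for almost all `ω` and `F s = g(s, ·)` in `L^q(Ω)` for almost all
`s`. Such an `F` is unique up to equality `μ`-almost everywhere. -/
def IsSectionMap {p q : ℝ≥0∞} [Fact (1 ≤ q)] (μ : Measure S) (P : Measure Ω)
    (η : Ω → Lp ℝ p μ) (F : S → Lp ℝ q P) : Prop :=
  AEStronglyMeasurable F μ ∧
    ∃ g : S × Ω → ℝ, Measurable g ∧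
      (∀ᵐ ω ∂P, (η ω : S → ℝ) =ᵐ[μ] fun s => g (s, ω)) ∧
      (∀ᵐ s ∂μ, (F s : Ω → ℝ) =ᵐ[P] fun ω => g (s, ω))

/-- The random variable `η : Ω → L^p(S)` belongs to `L^p(S; L^q(Ω))`. -/
def MemMixed {p : ℝ≥0∞} (q : ℝ≥0∞) [Fact (1 ≤ q)] (μ : Measure S) (P : Measure Ω)
    (η : Ω → Lp ℝ p μ) : Prop :=
  ∃ F : S → Lp ℝ q P, IsSectionMap μ P η F ∧ MemLp F p μ

/-- The norm of `η` in `L^p(S; L^q(Ω))`. All section maps of `η` agree almost everywhere, so that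
the infimum is over a single value (over nothing, with value `∞`, if there is no section map). -/
def eMixedNorm {p : ℝ≥0∞} (q : ℝ≥0∞) [Fact (1 ≤ q)] (μ : Measure S) (P : Measure Ω)
    (η : Ω → Lp ℝ p μ) : ℝ≥0∞ :=
  ⨅ (F : S → Lp ℝ q P) (_ : IsSectionMap μ P η F), eLpNorm F p μ

open Classical in
/-- The constant `C_{SL,q,p}(X)`. -/
def constSL {p : ℝ≥0∞} (q : ℝ≥0∞) [Fact (1 ≤ p)] [Fact (1 ≤ q)] (μ : Measure S) (P : Measure Ω)
    (X : Ω → Lp ℝ p μ) : ℝ :=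
  if q < p then
    2 * kahaneKhintchineK.{u} q (min q 2) * khintchineB p *
      (eLpNorm (fun ω => X ω - ∫ ω', X ω' ∂P) q P).toReal
  else
    2 * khintchineB q * (eMixedNorm q μ P (fun ω => X ω - ∫ ω', X ω' ∂P)).toReal

end Mixed

end

/-!
Averaging over independent centred summands is a contraction of `L^q`, so dropping summands, and
hence up to a factor `2` also changing their signs, does not increase the `L^q` norm of the sum of
`Y_j = X_j - 𝔼 X_1`. Averaging over the signs bounds that norm by twice the norm of the Rademacher
sum `∑ r_j Y_j`.

If `q < p`, the Kahane–Khintchine inequality lowers the exponent in the signs from `q` to `min q 2`,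
monotonicity raises it to `p`, and for the exponent `p` Tonelli reduces the Rademacher sum in
`L^p(S)` to scalar ones. If `p ≤ q`, Minkowski's integral inequality moves the integration over `S`
to the outside, which leaves scalar Rademacher sums as well. In both cases Khintchine's inequality
yields an `ℓ²` norm of the summands, dominated by their `ℓ^t` norm with `t = min q 2`; for `M`
identically distributed summands the latter is `M^(1/t)` times the norm of one of them.

The infima defining the constants are over nonempty sets by the hypercontractivity of Rademacher
sums. The mixed norm of `Y_j` does not depend on `j` because `∫_A 𝔼 |Y_j(s)|^q dμ(s)` is the
expectation of a Borel functional of `Y_j`. The convergence statement is the strong law of large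
numbers in `L^q`.
-/

section LpNorms

variable {α β ι : Type*} [MeasurableSpace α] [MeasurableSpace β] {μ : Measure α} {ν : Measure β}
  {p q : ℝ≥0∞}

theorem sum_rpow_le_rpow_sum (s : Finset ι) (f : ι → ℝ≥0∞) {t : ℝ} (ht : 1 ≤ t) :
    ∑ i ∈ s, f i ^ t ≤ (∑ i ∈ s, f i) ^ t := by
  classical
  induction s using Finset.induction_on with
  | empty => simp
  | insert i s hi ih =>
    rw [Finset.sum_insert hi, Finset.sum_insert hi]
    exact (add_le_add le_rfl ih).trans (ENNReal.add_rpow_le_rpow_add _ _ ht)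

theorem rpow_sum_rpow_anti (s : Finset ι) (f : ι → ℝ≥0∞) {t u : ℝ} (ht : 0 < t) (htu : t ≤ u) :
    (∑ i ∈ s, f i ^ u) ^ (1 / u) ≤ (∑ i ∈ s, f i ^ t) ^ (1 / t) := by
  have hu : 0 < u := ht.trans_le htu
  calc (∑ i ∈ s, f i ^ u) ^ (1 / u)
      = (∑ i ∈ s, (f i ^ t) ^ (u / t)) ^ (1 / u) := by
        simp only [← ENNReal.rpow_mul, mul_div_cancel₀ u ht.ne']
    _ ≤ ((∑ i ∈ s, f i ^ t) ^ (u / t)) ^ (1 / u) := by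
        gcongr
        exact sum_rpow_le_rpow_sum s _ ((one_le_div ht).2 htu)
    _ = (∑ i ∈ s, f i ^ t) ^ (1 / t) := by
        rw [← ENNReal.rpow_mul]
        congr 1
        field_simp

theorem eLpNorm_rpow_sum_rpow_le {ε : Type*} [TopologicalSpace ε] [ContinuousENorm ε]
    (s : Finset ι) {f : ι → α → ε} (hf : ∀ i, AEStronglyMeasurable (f i) μ) {t : ℝ} (ht : 0 < t)
    (htq : ENNReal.ofReal t ≤ q) :
    eLpNorm (fun x => (∑ i ∈ s, ‖f i x‖ₑ ^ t) ^ (1 / t)) q μ ≤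
      (∑ i ∈ s, eLpNorm (f i) q μ ^ t) ^ (1 / t) := by
  have ht0 : ENNReal.ofReal t ≠ 0 := by simpa using ht
  set q' := q / ENNReal.ofReal t
  have hq' : q' * ENNReal.ofReal t = q := ENNReal.div_mul_cancel ht0 ENNReal.ofReal_ne_top
  have hq1 : 1 ≤ q' := (ENNReal.le_div_iff_mul_le (.inl ht0) (.inl ENNReal.ofReal_ne_top)).2 <| by
    rwa [one_mul]
  have root : q * ENNReal.ofReal (1 / t) = q' := by
    rw [← hq', mul_assoc, ← ENNReal.ofReal_mul ht.le, mul_one_div_cancel ht.ne',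
      ENNReal.ofReal_one, mul_one]
  calc eLpNorm (fun x => (∑ i ∈ s, ‖f i x‖ₑ ^ t) ^ (1 / t)) q μ
      = eLpNorm (∑ i ∈ s, fun x => ‖f i x‖ₑ ^ t) q' μ ^ (1 / t) := by
        rw [← root, ← eLpNorm_enorm_rpow _ (by positivity)]
        simp only [enorm_eq_self, Finset.sum_apply]
    _ ≤ (∑ i ∈ s, eLpNorm (fun x => ‖f i x‖ₑ ^ t) q' μ) ^ (1 / t) := by
        gcongr
        exact eLpNorm_sum_le
          (fun i _ => ((hf i).enorm.pow_const t).aestronglyMeasurable) hq1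
    _ = (∑ i ∈ s, eLpNorm (f i) q μ ^ t) ^ (1 / t) := by
        simp only [eLpNorm_enorm_rpow _ ht, hq']

theorem eLpNorm_prod {ε : Type*} [TopologicalSpace ε] [ContinuousENorm ε] [SFinite ν]
    {f : α × β → ε} (hf : AEStronglyMeasurable f (μ.prod ν)) (hp : p ≠ ∞) :
    eLpNorm f p (μ.prod ν) = eLpNorm (fun x => eLpNorm (fun y => f (x, y)) p ν) p μ := by
  rcases eq_or_ne p 0 with rfl | hp0
  · simp
  have hp' : p.toReal ≠ 0 := (ENNReal.toReal_pos hp0 hp).ne'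
  simp only [eLpNorm_eq_lintegral_rpow_enorm_toReal hp0 hp, enorm_eq_self, ← ENNReal.rpow_mul,
    one_div_mul_cancel hp', ENNReal.rpow_one]
  rw [lintegral_prod _ (hf.enorm.pow_const _)]

theorem eLpNorm_prod_symm {ε : Type*} [TopologicalSpace ε] [ContinuousENorm ε] [SFinite μ]
    [SFinite ν] {f : α × β → ε} (hf : AEStronglyMeasurable f (μ.prod ν)) (hp : p ≠ ∞) :
    eLpNorm f p (μ.prod ν) = eLpNorm (fun y => eLpNorm (fun x => f (x, y)) p μ) p ν := by
  rw [← eLpNorm_comp_measurePreserving hf Measure.measurePreserving_swap]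
  exact eLpNorm_prod hf.prod_swap hp

/-- If `(∫ f(x, y) dμ)^s` dominates a function with finite integral, Hölder's inequality with the
conjugate exponents `s` and `t` can be divided by the factor `(∫ g)^(1/t)` it produces. -/
theorem rpow_lintegral_le_of_le_rpow_lintegral [SFinite μ] [SFinite ν] {f : α → β → ℝ≥0∞}
    (hf : Measurable (Function.uncurry f)) {s : ℝ} (hs : 1 < s) {g : β → ℝ≥0∞} (hg : Measurable g)
    (hgf : ∀ y, g y ≤ (∫⁻ x, f x y ∂μ) ^ s) (hfin : ∫⁻ y, g y ∂ν ≠ ∞) :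
    (∫⁻ y, g y ∂ν) ^ (1 / s) ≤ ∫⁻ x, (∫⁻ y, f x y ^ s ∂ν) ^ (1 / s) ∂μ := by
  rcases eq_or_ne (∫⁻ y, g y ∂ν) 0 with h0 | h0
  · rw [h0, ENNReal.zero_rpow_of_pos (by positivity)]
    exact zero_le
  have hst := Real.HolderConjugate.conjExponent hs
  set t := s.conjExponent
  have hs0 : 0 < s := by positivity
  have ht : 0 < t := hst.symm.pos
  have hadd : 1 / s + 1 / t = 1 := by simpa using hst.inv_add_inv_eq_one
  have hm : Measurable fun z : β × α => f z.2 z.1 * g z.1 ^ (1 / t) :=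
    (hf.comp measurable_swap).mul ((hg.comp measurable_fst).pow_const _)
  have hle : ∫⁻ y, g y ∂ν ≤
      (∫⁻ x, (∫⁻ y, f x y ^ s ∂ν) ^ (1 / s) ∂μ) * (∫⁻ y, g y ∂ν) ^ (1 / t) := calc
    ∫⁻ y, g y ∂ν = ∫⁻ y, g y ^ (1 / s) * g y ^ (1 / t) ∂ν := by
      simp only [← ENNReal.rpow_add_of_nonneg _ _ (one_div_pos.2 hs0).le (one_div_pos.2 ht).le,
        hadd, ENNReal.rpow_one]
    _ ≤ ∫⁻ y, (∫⁻ x, f x y ∂μ) * g y ^ (1 / t) ∂ν := by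
      gcongr with y
      simpa only [one_div] using (ENNReal.rpow_inv_le_iff hs0).2 (hgf y)
    _ = ∫⁻ x, ∫⁻ y, f x y * g y ^ (1 / t) ∂ν ∂μ := by
      simp only [← lintegral_mul_const _ hf.of_uncurry_right]
      exact lintegral_lintegral_swap hm.aemeasurable
    _ ≤ ∫⁻ x, (∫⁻ y, f x y ^ s ∂ν) ^ (1 / s) * (∫⁻ y, g y ∂ν) ^ (1 / t) ∂μ := by
      gcongr with x
      simpa only [Pi.mul_apply, ← ENNReal.rpow_mul, one_div_mul_cancel ht.ne', ENNReal.rpow_one]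
        using ENNReal.lintegral_mul_le_Lp_mul_Lq ν hst hf.of_uncurry_left.aemeasurable
          (hg.pow_const (1 / t)).aemeasurable
    _ = (∫⁻ x, (∫⁻ y, f x y ^ s ∂ν) ^ (1 / s) ∂μ) * (∫⁻ y, g y ∂ν) ^ (1 / t) :=
      lintegral_mul_const _ ((Measurable.lintegral_prod_right' (hf.pow_const s)).pow_const _)
  refine (ENNReal.mul_le_mul_iff_left (c := (∫⁻ y, g y ∂ν) ^ (1 / t)) (by simp [h0, hfin])
    (by simp [h0, hfin])).1 ?_
  rwa [← ENNReal.rpow_add _ _ h0 hfin, hadd, ENNReal.rpow_one]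

/-- **Minkowski's integral inequality**. Exhausting the integrand on the left by simple functions
with finite integral permits the division in Hölder's inequality. -/
theorem lintegral_rpow_lintegral_le [SFinite μ] [SigmaFinite ν] {f : α → β → ℝ≥0∞}
    (hf : Measurable (Function.uncurry f)) {s : ℝ} (hs : 1 ≤ s) :
    (∫⁻ y, (∫⁻ x, f x y ∂μ) ^ s ∂ν) ^ (1 / s) ≤ ∫⁻ x, (∫⁻ y, f x y ^ s ∂ν) ^ (1 / s) ∂μ := by
  rcases hs.eq_or_lt with rfl | hs1
  · simp only [ENNReal.rpow_one, div_one]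
    exact (lintegral_lintegral_swap hf.aemeasurable).ge
  rw [one_div, ENNReal.rpow_inv_le_iff (by positivity)]
  refine le_of_forall_lt fun L hL => ?_
  rw [lintegral_eq_nnreal] at hL
  simp only [lt_iSup_iff, ← SimpleFunc.lintegral_eq_lintegral] at hL
  obtain ⟨φ, hφ, hLφ⟩ := hL
  obtain ⟨g, hgφ, hgfin, hLg⟩ := exists_lt_lintegral_simpleFunc_of_lt_lintegral hLφ
  refine hLg.trans_le ((ENNReal.rpow_inv_le_iff (by positivity)).1 ?_)
  rw [← one_div]
  exact rpow_lintegral_le_of_le_rpow_lintegral hf hs1 g.measurable.coe_nnreal_ennreal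
    (fun y => (ENNReal.coe_le_coe.2 (hgφ y)).trans (hφ y)) hgfin.ne

theorem eLpNorm_eLpNorm_le_eLpNorm_eLpNorm {ε : Type*} [TopologicalSpace ε] [ContinuousENorm ε]
    [MeasurableSpace ε] [OpensMeasurableSpace ε] [SFinite μ] [SigmaFinite ν] {f : α × β → ε}
    (hf : Measurable f) (hpq : p ≤ q) (hq : q ≠ ∞) :
    eLpNorm (fun y => eLpNorm (fun x => f (x, y)) p μ) q ν ≤
      eLpNorm (fun x => eLpNorm (fun y => f (x, y)) q ν) p μ := by
  rcases eq_or_ne p 0 with rfl | hp0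
  · simp
  have hq0 : q ≠ 0 := (hp0.bot_lt.trans_le hpq).ne'
  have hp := ne_top_of_le_ne_top hq hpq
  have hp' : 0 < p.toReal := ENNReal.toReal_pos hp0 hp
  have hs : 1 ≤ q.toReal / p.toReal := (one_le_div hp').2 (ENNReal.toReal_mono hq hpq)
  have h := lintegral_rpow_lintegral_le (μ := μ) (ν := ν)
    (f := fun x y => ‖f (x, y)‖ₑ ^ p.toReal) (hf.enorm.pow_const _) hs
  have h' := ENNReal.rpow_le_rpow h (one_div_pos.2 hp').le
  have e₁ : 1 / (q.toReal / p.toReal) * (1 / p.toReal) = 1 / q.toReal := by field_simp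
  have e₂ : 1 / p.toReal * q.toReal = q.toReal / p.toReal := by field_simp
  have e₃ : 1 / q.toReal * p.toReal = 1 / (q.toReal / p.toReal) := by field_simp
  simpa only [eLpNorm_eq_lintegral_rpow_enorm_toReal hp0 hp,
    eLpNorm_eq_lintegral_rpow_enorm_toReal hq0 hq, enorm_eq_self, ← ENNReal.rpow_mul, e₁, e₂, e₃,
    mul_div_cancel₀ q.toReal hp'.ne'] using h'

end LpNorms

section TwoPoint

/-- Squaring both terms on the left replaces `(a, b)` by `(a² + ρ²b²/4, ab)` with `ρ = 2⁻ᵐ`. -/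
theorem add_pow_add_sub_pow_le (m : ℕ) (a b : ℝ) :
    (a + (1 / 2) ^ m * b) ^ (2 * 2 ^ m) + (a - (1 / 2) ^ m * b) ^ (2 * 2 ^ m) ≤
      2 * (a ^ 2 + b ^ 2) ^ 2 ^ m := by
  induction m generalizing a b with
  | zero => simp; nlinarith
  | succ m ih =>
    have half : (1 / 2 : ℝ) ^ (m + 1) = (1 / 2) ^ m / 2 := by ring
    have two_mul_pow : 2 ^ (m + 1) = 2 * 2 ^ m := by ring
    set ρ : ℝ := (1 / 2) ^ m
    have hρ0 : 0 ≤ ρ := by positivity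
    have hρ1 : ρ ≤ 1 := pow_le_one₀ (by norm_num) (by norm_num)
    have sq_bound :
        (a ^ 2 + ρ ^ 2 / 4 * b ^ 2) ^ 2 + (a * b) ^ 2 ≤ (a ^ 2 + b ^ 2) ^ 2 := by
      have h₁ : 0 ≤ a ^ 2 * b ^ 2 * (1 - ρ ^ 2) :=
        mul_nonneg (by positivity) (sub_nonneg.2 (pow_le_one₀ hρ0 hρ1))
      have h₂ : 0 ≤ b ^ 4 * (1 - ρ ^ 4) :=
        mul_nonneg (by positivity) (sub_nonneg.2 (pow_le_one₀ hρ0 hρ1))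
      nlinarith [sq_nonneg (a * b), sq_nonneg (b ^ 2)]
    calc (a + (1 / 2) ^ (m + 1) * b) ^ (2 * 2 ^ (m + 1)) +
          (a - (1 / 2) ^ (m + 1) * b) ^ (2 * 2 ^ (m + 1))
        = (a ^ 2 + ρ ^ 2 / 4 * b ^ 2 + ρ * (a * b)) ^ (2 * 2 ^ m) +
          (a ^ 2 + ρ ^ 2 / 4 * b ^ 2 - ρ * (a * b)) ^ (2 * 2 ^ m) := by
          rw [half, two_mul_pow, pow_mul (a + ρ / 2 * b), pow_mul (a - ρ / 2 * b)]
          congr 2 <;> ring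
      _ ≤ 2 * ((a ^ 2 + ρ ^ 2 / 4 * b ^ 2) ^ 2 + (a * b) ^ 2) ^ 2 ^ m := ih _ _
      _ ≤ 2 * ((a ^ 2 + b ^ 2) ^ 2) ^ 2 ^ m := by gcongr
      _ = 2 * (a ^ 2 + b ^ 2) ^ 2 ^ (m + 1) := by rw [two_mul_pow, ← pow_mul]

variable {E : Type*} [NormedAddCommGroup E] [NormedSpace ℝ E]

theorem norm_add_smul_le {ρ : ℝ} (h₁ : -1 ≤ ρ) (h₂ : ρ ≤ 1) (x y : E) :
    ‖x + ρ • y‖ ≤ (‖x + y‖ + ‖x - y‖) / 2 + ρ * ((‖x + y‖ - ‖x - y‖) / 2) := by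
  calc ‖x + ρ • y‖ = ‖((1 + ρ) / 2) • (x + y) + ((1 - ρ) / 2) • (x - y)‖ := by congr 1; module
    _ ≤ (1 + ρ) / 2 * ‖x + y‖ + (1 - ρ) / 2 * ‖x - y‖ := by
      refine (norm_add_le _ _).trans_eq ?_
      rw [norm_smul, norm_smul, Real.norm_of_nonneg (by linarith),
        Real.norm_of_nonneg (by linarith)]
    _ = _ := by ring

theorem norm_add_pow_add_norm_sub_pow_le (m : ℕ) (x y : E) :
    ‖x + (1 / 2 : ℝ) ^ m • y‖ ^ (2 * 2 ^ m) + ‖x - (1 / 2 : ℝ) ^ m • y‖ ^ (2 * 2 ^ m) ≤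
      2 * ((‖x + y‖ ^ 2 + ‖x - y‖ ^ 2) / 2) ^ 2 ^ m := by
  have hρ0 : (0 : ℝ) ≤ (1 / 2) ^ m := by positivity
  have hρ1 : (1 / 2 : ℝ) ^ m ≤ 1 := pow_le_one₀ (by norm_num) (by norm_num)
  have hadd := norm_add_smul_le (by linarith) hρ1 x y
  have hsub := norm_add_smul_le (neg_le_neg hρ1) (by linarith) x y
  rw [neg_smul, ← sub_eq_add_neg, neg_mul, ← sub_eq_add_neg] at hsub
  calc _ ≤ _ := add_le_add (pow_le_pow_left₀ (norm_nonneg _) hadd _)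
        (pow_le_pow_left₀ (norm_nonneg _) hsub _)
    _ ≤ _ := add_pow_add_sub_pow_le m _ _
    _ = _ := by ring_nf

theorem enorm_add_pow_add_enorm_sub_pow_le (m : ℕ) (x y : E) :
    (‖x + (1 / 2 : ℝ) ^ m • y‖ₑ ^ (2 * 2 ^ m) + ‖x - (1 / 2 : ℝ) ^ m • y‖ₑ ^ (2 * 2 ^ m)) / 2 ≤
      ((‖x + y‖ₑ ^ 2 + ‖x - y‖ₑ ^ 2) / 2) ^ 2 ^ m := by
  have h := ENNReal.ofReal_le_ofReal (norm_add_pow_add_norm_sub_pow_le m x y)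
  rw [ENNReal.ofReal_add (by positivity) (by positivity), ENNReal.ofReal_mul (by norm_num),
    ENNReal.ofReal_pow (norm_nonneg _), ENNReal.ofReal_pow (norm_nonneg _),
    ENNReal.ofReal_pow (by positivity), ENNReal.ofReal_div_of_pos (by norm_num),
    ENNReal.ofReal_add (by positivity) (by positivity), ENNReal.ofReal_pow (norm_nonneg _),
    ENNReal.ofReal_pow (norm_nonneg _)] at h
  simp only [ofReal_norm, ENNReal.ofReal_ofNat] at h
  exact ENNReal.div_le_of_le_mul' h

end TwoPoint

theorem lintegral_half_add_pow_le {α : Type*} [MeasurableSpace α] {μ : Measure α} {k : ℕ}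
    (hk : k ≠ 0) {f g : α → ℝ≥0∞} (hf : Measurable f) (hg : Measurable g) {A B : ℝ≥0∞}
    (hA : ∫⁻ a, f a ^ k ∂μ ≤ A ^ k) (hB : ∫⁻ a, g a ^ k ∂μ ≤ B ^ k) :
    ∫⁻ a, ((f a + g a) / 2) ^ k ∂μ ≤ ((A + B) / 2) ^ k := by
  have hk0 : (0 : ℝ) < k := by positivity
  have minkowski := ENNReal.lintegral_Lp_add_le (μ := μ) (p := k) hf.aemeasurable hg.aemeasurable
    (by exact_mod_cast Nat.one_le_iff_ne_zero.2 hk)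
  simp only [ENNReal.rpow_natCast, Pi.add_apply, one_div] at minkowski
  have root {C D : ℝ≥0∞} : C ^ ((k : ℝ)⁻¹) ≤ D ↔ C ≤ D ^ k := by
    rw [ENNReal.rpow_inv_le_iff hk0, ENNReal.rpow_natCast]
  have hsum := root.1 (minkowski.trans (add_le_add (root.2 hA) (root.2 hB)))
  simp only [ENNReal.div_eq_inv_mul, mul_pow]
  rw [lintegral_const_mul _ (by fun_prop)]
  gcongr

theorem lintegral_comp_prodMk_of_indepFun {Ω β γ : Type*} [MeasurableSpace Ω] [MeasurableSpace β]
    [MeasurableSpace γ] {P : Measure Ω} [IsFiniteMeasure P] {X : Ω → β} {Y : Ω → γ}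
    (hXY : IndepFun X Y P) (hX : Measurable X) (hY : Measurable Y) {F : β × γ → ℝ≥0∞}
    (hF : Measurable F) :
    ∫⁻ ω, F (X ω, Y ω) ∂P = ∫⁻ ω', ∫⁻ ω, F (X ω', Y ω) ∂P ∂P := calc
  ∫⁻ ω, F (X ω, Y ω) ∂P = ∫⁻ z, F z ∂P.map (fun ω => (X ω, Y ω)) :=
    (lintegral_map hF (hX.prodMk hY)).symm
  _ = ∫⁻ x, ∫⁻ y, F (x, y) ∂P.map Y ∂P.map X := by
    rw [(indepFun_iff_map_prod_eq_prod_map_map hX.aemeasurable hY.aemeasurable).1 hXY,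
      lintegral_prod _ hF.aemeasurable]
  _ = ∫⁻ ω', ∫⁻ y, F (X ω', y) ∂P.map Y ∂P := lintegral_map hF.lintegral_prod_right' hX
  _ = ∫⁻ ω', ∫⁻ ω, F (X ω', Y ω) ∂P ∂P :=
    lintegral_congr fun _ => lintegral_map (hF.comp measurable_prodMk_left) hY

namespace IsRademacherFamily

variable {Ω : Type} [MeasurableSpace Ω] {P : Measure Ω} {r : ℕ → Ω → ℝ}
  {E : Type*} [NormedAddCommGroup E] [NormedSpace ℝ E]

theorem lintegral_comp (hr : IsRademacherFamily P r) (j : ℕ) (φ : ℝ → ℝ≥0∞) :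
    ∫⁻ ω, φ (r j ω) ∂P = (φ 1 + φ (-1)) / 2 := by
  have hone : MeasurableSet {ω | r j ω = 1} := hr.measurable j (measurableSet_singleton 1)
  have hcompl : {ω | r j ω = 1}ᶜ = {ω | r j ω = -1} := by
    ext ω
    rcases hr.values j ω with h | h <;> norm_num [h]
  have hpart (c : ℝ) (hc : MeasurableSet {ω | r j ω = c}) (hPc : P {ω | r j ω = c} = 1 / 2) :
      ∫⁻ ω in {ω | r j ω = c}, φ (r j ω) ∂P = φ c / 2 := by
    rw [setLIntegral_congr_fun (g := fun _ => φ c) hc fun ω hω => congrArg φ hω,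
      setLIntegral_const, hPc, mul_one_div]
  rw [← lintegral_add_compl _ hone, hcompl, hpart 1 hone (hr.prob_one j),
    hpart (-1) (hcompl ▸ hone.compl) (hr.prob_neg_one j), ENNReal.add_div]

theorem lintegral_sum_succ [IsProbabilityMeasure P] (hr : IsRademacherFamily P r)
    {F : E → ℝ≥0∞} (hF : Continuous F) (n : ℕ) (x : ℕ → E) (y : E) :
    ∫⁻ ω, F (y + ∑ j ∈ Finset.range (n + 1), r j ω • x j) ∂P =
      ((∫⁻ ω, F (y + x n + ∑ j ∈ Finset.range n, r j ω • x j) ∂P) +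
        ∫⁻ ω, F (y - x n + ∑ j ∈ Finset.range n, r j ω • x j) ∂P) / 2 := by
  let G : (({n} : Finset ℕ) → ℝ) × (Finset.range n → ℝ) → ℝ≥0∞ := fun v =>
    F (y + v.1 ⟨n, by simp⟩ • x n + ∑ j : Finset.range n, v.2 j • x j)
  have hG : Measurable G := Continuous.measurable (by fun_prop)
  have hsplit := lintegral_comp_prodMk_of_indepFun
    (hr.indep.indepFun_finset {n} (Finset.range n) (by simp) hr.measurable)
    (measurable_pi_lambda _ fun j => hr.measurable j)
    (measurable_pi_lambda _ fun j => hr.measurable j) hG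
  have hcoe (ω : Ω) :
      ∑ j : Finset.range n, r j ω • x j = ∑ j ∈ Finset.range n, r j ω • x j :=
    Finset.sum_coe_sort (Finset.range n) fun j => r j ω • x j
  simp only [G, hcoe] at hsplit
  calc ∫⁻ ω, F (y + ∑ j ∈ Finset.range (n + 1), r j ω • x j) ∂P
      = ∫⁻ ω, F (y + r n ω • x n + ∑ j ∈ Finset.range n, r j ω • x j) ∂P := by
        simp only [Finset.sum_range_succ, add_assoc, add_comm (r n _ • x n)]
    _ = ∫⁻ ω', ∫⁻ ω, F (y + r n ω' • x n + ∑ j ∈ Finset.range n, r j ω • x j) ∂P ∂P := hsplit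
    _ = _ := by
        rw [hr.lintegral_comp n fun s =>
          ∫⁻ ω, F (y + s • x n + ∑ j ∈ Finset.range n, r j ω • x j) ∂P]
        simp only [one_smul, neg_smul, ← sub_eq_add_neg]

theorem measurable_comp_sum (hr : IsRademacherFamily P r) {F : E → ℝ≥0∞} (hF : Continuous F)
    (n : ℕ) (x : ℕ → E) (y : E) :
    Measurable fun ω => F (y + ∑ j ∈ Finset.range n, r j ω • x j) := by
  have hcont : Continuous fun v : ℕ → ℝ => F (y + ∑ j ∈ Finset.range n, v j • x j) := by fun_prop
  exact hcont.measurable.comp (measurable_pi_lambda _ hr.measurable)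

theorem lintegral_hypercontractive [IsProbabilityMeasure P] (hr : IsRademacherFamily P r)
    (m n : ℕ) (x : ℕ → E) (y : E) :
    ∫⁻ ω, ‖y + ∑ j ∈ Finset.range n, r j ω • (1 / 2 : ℝ) ^ m • x j‖ₑ ^ (2 * 2 ^ m) ∂P ≤
      (∫⁻ ω, ‖y + ∑ j ∈ Finset.range n, r j ω • x j‖ₑ ^ 2 ∂P) ^ 2 ^ m := by
  have hcont (k : ℕ) : Continuous fun z : E => ‖z‖ₑ ^ k :=
    (ENNReal.continuous_pow k).comp continuous_enorm
  induction n generalizing y with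
  | zero => simp [pow_mul]
  | succ n ih =>
    let S (z : E) (ω : Ω) : E := z + ∑ j ∈ Finset.range n, r j ω • (1 / 2 : ℝ) ^ m • x j
    have hS (k : ℕ) (z : E) : Measurable fun ω => ‖S z ω‖ₑ ^ k :=
      hr.measurable_comp_sum (hcont k) n _ z
    have hshift (z w : E) (ω : Ω) : S (z + w) ω = S z ω + w := by
      simp only [S, add_right_comm]
    rw [hr.lintegral_sum_succ (hcont _), hr.lintegral_sum_succ (hcont _)]
    calc ((∫⁻ ω, ‖S (y + (1 / 2 : ℝ) ^ m • x n) ω‖ₑ ^ (2 * 2 ^ m) ∂P) +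
          ∫⁻ ω, ‖S (y - (1 / 2 : ℝ) ^ m • x n) ω‖ₑ ^ (2 * 2 ^ m) ∂P) / 2
        = ∫⁻ ω, (‖S y ω + (1 / 2 : ℝ) ^ m • x n‖ₑ ^ (2 * 2 ^ m) +
            ‖S y ω - (1 / 2 : ℝ) ^ m • x n‖ₑ ^ (2 * 2 ^ m)) / 2 ∂P := by
          rw [← lintegral_add_left (hS _ _)]
          simp only [ENNReal.div_eq_inv_mul, sub_eq_add_neg, hshift]
          rw [lintegral_const_mul' _ _ (by simp)]
      _ ≤ ∫⁻ ω, ((‖S (y + x n) ω‖ₑ ^ 2 + ‖S (y - x n) ω‖ₑ ^ 2) / 2) ^ 2 ^ m ∂P := by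
          gcongr with ω
          simpa only [hshift, sub_eq_add_neg] using
            enorm_add_pow_add_enorm_sub_pow_le m (S y ω) (x n)
      _ ≤ _ := lintegral_half_add_pow_le (by positivity) (hS 2 _) (hS 2 _)
          (by simpa only [S, ← pow_mul] using ih (y + x n))
          (by simpa only [S, ← pow_mul] using ih (y - x n))

theorem lintegral_sq [IsProbabilityMeasure P] (hr : IsRademacherFamily P r) (n : ℕ) (a : ℕ → ℝ)
    (y : ℝ) :
    ∫⁻ ω, ‖y + ∑ j ∈ Finset.range n, r j ω • a j‖ₑ ^ 2 ∂P =
      ENNReal.ofReal (y ^ 2 + ∑ j ∈ Finset.range n, a j ^ 2) := by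
  induction n generalizing y with
  | zero => simp [Real.enorm_eq_ofReal_abs, ← ENNReal.ofReal_pow]
  | succ n ih =>
    have hnonneg (z : ℝ) : 0 ≤ z ^ 2 + ∑ j ∈ Finset.range n, a j ^ 2 :=
      add_nonneg (sq_nonneg z) (Finset.sum_nonneg fun _ _ => sq_nonneg _)
    have hcont : Continuous fun z : ℝ => ‖z‖ₑ ^ 2 :=
      (ENNReal.continuous_pow 2).comp continuous_enorm
    rw [hr.lintegral_sum_succ hcont, ih, ih,
      ← ENNReal.ofReal_add (hnonneg _) (hnonneg _), Finset.sum_range_succ,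
      ← ENNReal.ofReal_ofNat 2, ← ENNReal.ofReal_div_of_pos (by norm_num)]
    congr 1
    ring

theorem stronglyMeasurable_sum (hr : IsRademacherFamily P r) (n : ℕ) (x : ℕ → E) :
    StronglyMeasurable fun ω => ∑ j ∈ Finset.range n, r j ω • x j :=
  Finset.stronglyMeasurable_fun_sum _ fun j _ =>
    (hr.measurable j).stronglyMeasurable.smul_const (x j)

theorem memLp_sum [IsFiniteMeasure P] (hr : IsRademacherFamily P r) (n : ℕ) (x : ℕ → E)
    (p : ℝ≥0∞) : MemLp (fun ω => ∑ j ∈ Finset.range n, r j ω • x j) p P := by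
  refine MemLp.of_bound (hr.stronglyMeasurable_sum n x).aestronglyMeasurable
    (∑ j ∈ Finset.range n, ‖x j‖) (ae_of_all _ fun ω => norm_sum_le_of_le _ fun j _ => ?_)
  rcases hr.values j ω with h | h <;> simp [h]

theorem eLpNorm_sum_half_pow_le [IsProbabilityMeasure P] (hr : IsRademacherFamily P r) (m n : ℕ)
    (x : ℕ → E) :
    eLpNorm (fun ω => ∑ j ∈ Finset.range n, r j ω • (1 / 2 : ℝ) ^ m • x j)
        ((2 * 2 ^ m : ℕ) : ℝ≥0∞) P ≤
      eLpNorm (fun ω => ∑ j ∈ Finset.range n, r j ω • x j) 2 P := by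
  have h := hr.lintegral_hypercontractive m n x 0
  simp only [zero_add] at h
  have hN : (0 : ℝ) < ((2 * 2 ^ m : ℕ) : ℝ) := by positivity
  have hexp : 1 / (2 : ℝ≥0∞).toReal * ((2 * 2 ^ m : ℕ) : ℝ) = ((2 ^ m : ℕ) : ℝ) := by simp
  rw [eLpNorm_eq_lintegral_rpow_enorm_toReal (by simp) (ENNReal.natCast_ne_top _),
    eLpNorm_eq_lintegral_rpow_enorm_toReal two_ne_zero ENNReal.ofNat_ne_top,
    ENNReal.toReal_natCast, one_div ((2 * 2 ^ m : ℕ) : ℝ), ENNReal.rpow_inv_le_iff hN,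
    ← ENNReal.rpow_mul, hexp]
  simpa only [ENNReal.rpow_natCast, ENNReal.toReal_ofNat, ENNReal.rpow_ofNat] using h

theorem eLpNorm_sum_two_pow_le [IsProbabilityMeasure P] (hr : IsRademacherFamily P r) (m n : ℕ)
    (x : ℕ → E) :
    eLpNorm (fun ω => ∑ j ∈ Finset.range n, r j ω • x j) ((2 * 2 ^ m : ℕ) : ℝ≥0∞) P ≤
      ENNReal.ofReal (2 ^ m) * eLpNorm (fun ω => ∑ j ∈ Finset.range n, r j ω • x j) 2 P := by
  have hscale : (fun ω => ∑ j ∈ Finset.range n, r j ω • x j) =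
      (2 ^ m : ℝ) • fun ω => ∑ j ∈ Finset.range n, r j ω • (1 / 2 : ℝ) ^ m • x j := by
    funext ω
    rw [Pi.smul_apply, Finset.smul_sum]
    refine Finset.sum_congr rfl fun j _ => ?_
    rw [smul_comm, smul_smul (2 ^ m : ℝ), ← mul_pow]
    norm_num
  conv_lhs => rw [hscale]
  rw [eLpNorm_const_smul, Real.enorm_eq_ofReal (by positivity)]
  gcongr
  exact hr.eLpNorm_sum_half_pow_le m n x

theorem eLpNorm_sum_two [IsProbabilityMeasure P] (hr : IsRademacherFamily P r) (n : ℕ)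
    (a : ℕ → ℝ) :
    eLpNorm (fun ω => ∑ j ∈ Finset.range n, r j ω * a j) 2 P =
      ENNReal.ofReal (√(∑ j ∈ Finset.range n, a j ^ 2)) := by
  have h := hr.lintegral_sq n a 0
  simp only [zero_add, ne_eq, OfNat.ofNat_ne_zero, not_false_eq_true, zero_pow, smul_eq_mul] at h
  rw [eLpNorm_eq_lintegral_rpow_enorm_toReal two_ne_zero ENNReal.ofNat_ne_top,
    ENNReal.toReal_ofNat]
  simp only [ENNReal.rpow_ofNat, h]
  rw [ENNReal.ofReal_rpow_of_nonneg (Finset.sum_nonneg fun _ _ => sq_nonneg _) (by norm_num),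
    Real.sqrt_eq_rpow]

theorem exists_eLpNorm_sum_le_mul_eLpNorm_two {q : ℝ≥0∞} (hq : q ≠ ∞) :
    ∃ K : ℝ, 0 < K ∧
      ∀ (Ω : Type) [MeasurableSpace Ω] (P : Measure Ω) [IsProbabilityMeasure P] (r : ℕ → Ω → ℝ),
        IsRademacherFamily P r →
        ∀ (E : Type u) [NormedAddCommGroup E] [NormedSpace ℝ E] (n : ℕ) (x : ℕ → E),
          eLpNorm (fun ω => ∑ j ∈ Finset.range n, r j ω • x j) q P ≤
            ENNReal.ofReal K * eLpNorm (fun ω => ∑ j ∈ Finset.range n, r j ω • x j) 2 P := by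
  obtain ⟨m, hm⟩ := ENNReal.exists_nat_gt hq
  have hqm : q ≤ ((2 * 2 ^ m : ℕ) : ℝ≥0∞) := hm.le.trans <| by
    exact_mod_cast Nat.lt_two_pow_self.le.trans (Nat.le_mul_of_pos_left _ two_pos)
  exact ⟨2 ^ m, by positivity, fun Ω _ P _ r hr E _ _ n x =>
    (eLpNorm_le_eLpNorm_of_exponent_le hqm (hr.stronglyMeasurable_sum n x).aestronglyMeasurable
      ).trans (hr.eLpNorm_sum_two_pow_le m n x)⟩

theorem completion (hr : IsRademacherFamily P r) :
    IsRademacherFamily (Ω := NullMeasurableSpace Ω P) P.completion r where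
  measurable j _ hs := (hr.measurable j hs).nullMeasurableSet
  values := hr.values
  prob_neg_one j := (Measure.completion_apply P _).trans (hr.prob_neg_one j)
  prob_one j := (Measure.completion_apply P _).trans (hr.prob_one j)
  indep := iIndepFun_iff_measure_inter_preimage_eq_mul.2
    (iIndepFun_iff_measure_inter_preimage_eq_mul.1 hr.indep)

end IsRademacherFamily

/-- The law of a fair coin, used to build Rademacher families. -/
noncomputable def fairCoin : Measure Bool :=
  (2⁻¹ : ℝ≥0∞) • (Measure.dirac true + Measure.dirac false)

instance : IsProbabilityMeasure fairCoin :=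
  ⟨by simp [fairCoin, ENNReal.inv_two_add_inv_two]⟩

theorem isRademacherFamily_infinitePi_fairCoin :
    IsRademacherFamily (Measure.infinitePi fun _ : ℕ => fairCoin)
      fun j ω => if ω j then 1 else -1 := by
  let sign : Bool → ℝ := fun b => if b then 1 else -1
  have hsign : Measurable sign := measurable_of_countable _
  have hprob (j : ℕ) (b : Bool) :
      Measure.infinitePi (fun _ : ℕ => fairCoin) {ω | sign (ω j) = sign b} = 1 / 2 := by
    have hbox : {ω : ℕ → Bool | sign (ω j) = sign b} =
        (({j} : Finset ℕ) : Set ℕ).pi fun _ => {b} := by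
      ext ω
      cases b <;> cases h : ω j <;> norm_num [sign, h]
    rw [hbox, Measure.infinitePi_pi _ fun _ _ => measurableSet_singleton b]
    cases b <;> simp [fairCoin]
  exact
    { measurable := fun j => hsign.comp (measurable_pi_apply j)
      values := fun j ω => by cases ω j <;> simp
      prob_neg_one := fun j => hprob j false
      prob_one := fun j => hprob j true
      indep := iIndepFun_infinitePi (P := fun _ : ℕ => fairCoin) (X := fun _ => sign)
        fun _ => hsign }

theorem exists_isRademacherFamily :
    ∃ (R : Type) (_ : MeasurableSpace R) (Q : Measure R) (_ : IsProbabilityMeasure Q)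
      (_ : Q.IsComplete) (r : ℕ → R → ℝ), IsRademacherFamily Q r :=
  let Q := Measure.infinitePi fun _ : ℕ => fairCoin
  ⟨NullMeasurableSpace (ℕ → Bool) Q, inferInstance, Q.completion,
    ⟨(Measure.completion_apply Q _).trans measure_univ⟩, inferInstance, _,
    isRademacherFamily_infinitePi_fairCoin.completion⟩

theorem le_ofReal_sInf_mul {s : Set ℝ} (hs : s.Nonempty) (hpos : ∀ K ∈ s, 0 < K) {a c : ℝ≥0∞}
    (hc : c ≠ ∞) (h : ∀ K ∈ s, a ≤ ENNReal.ofReal K * c) : a ≤ ENNReal.ofReal (sInf s) * c := by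
  obtain ⟨k, -, hk, hks⟩ := exists_seq_tendsto_sInf hs ⟨0, fun K hK => (hpos K hK).le⟩
  exact ge_of_tendsto' (ENNReal.Tendsto.mul_const (ENNReal.tendsto_ofReal hk) (Or.inr hc))
    fun n => h _ (hks n)

theorem khintchineB_nonneg (q : ℝ≥0∞) : 0 ≤ khintchineB q :=
  Real.sInf_nonneg fun _ h => h.1.le

theorem kahaneKhintchineK_nonneg (q p : ℝ≥0∞) : 0 ≤ kahaneKhintchineK.{u} q p :=
  Real.sInf_nonneg fun _ h => h.1.le

theorem enorm_sum_smul_Lp {α ι : Type*} [Fintype ι] [MeasurableSpace α] {μ : Measure α}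
    {p : ℝ≥0∞} (c : ι → ℝ) {y : ι → Lp ℝ p μ} {h : ι → α → ℝ} (hy : ∀ i, y i =ᵐ[μ] h i) :
    ‖∑ i, c i • y i‖ₑ = eLpNorm (fun s => ∑ i, c i * h i s) p μ := by
  rw [Lp.enorm_def]
  refine eLpNorm_congr_ae ?_
  filter_upwards [Lp.coeFn_finsetSum Finset.univ fun i => c i • y i,
    ae_all_iff.2 fun i => Lp.coeFn_smul (c i) (y i), ae_all_iff.2 hy] with s hsum hsmul hs
  simp only [hsum, Finset.sum_apply, hsmul, Pi.smul_apply, smul_eq_mul, hs]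

namespace IsRademacherFamily

variable {R : Type} [MeasurableSpace R] {Q : Measure R} [IsProbabilityMeasure Q] [Q.IsComplete]
  {r : ℕ → R → ℝ} {n : ℕ} {p q : ℝ≥0∞}

theorem eLpNorm_sum_le_khintchineB (hr : IsRademacherFamily Q r) (hq : q ≠ ∞) (n : ℕ)
    (a : ℕ → ℝ) :
    eLpNorm (fun ω => ∑ j ∈ Finset.range n, r j ω * a j) q Q ≤
      ENNReal.ofReal (khintchineB q) * ENNReal.ofReal (√(∑ j ∈ Finset.range n, a j ^ 2)) := by
  refine le_ofReal_sInf_mul ?_ (fun K hK => hK.1) ENNReal.ofReal_ne_top fun K hK => ?_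
  · obtain ⟨K, hK, h⟩ := exists_eLpNorm_sum_le_mul_eLpNorm_two hq
    refine ⟨K, hK, fun Ω _ P _ _ r hr n a => (h Ω P r hr ℝ n a).trans_eq ?_⟩
    simp only [smul_eq_mul]
    rw [hr.eLpNorm_sum_two, ENNReal.ofReal_mul hK.le]
  · rw [← ENNReal.ofReal_mul hK.1.le]
    exact hK.2 R Q r hr n a

theorem eLpNorm_sum_le_kahaneKhintchineK {E : Type u} [NormedAddCommGroup E] [NormedSpace ℝ E]
    [CompleteSpace E] (hr : IsRademacherFamily Q r) (hq : q ≠ ∞) (n : ℕ) (x : ℕ → E) :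
    eLpNorm (fun ω => ∑ j ∈ Finset.range n, r j ω • x j) q Q ≤
      ENNReal.ofReal (kahaneKhintchineK.{u} q (min q 2)) *
        eLpNorm (fun ω => ∑ j ∈ Finset.range n, r j ω • x j) (min q 2) Q := by
  refine le_ofReal_sInf_mul ?_ (fun K hK => hK.1) (hr.memLp_sum n x _).eLpNorm_ne_top
    fun K hK => hK.2 R Q r hr E n x
  rcases le_total q 2 with h2 | h2
  · refine ⟨1, one_pos, fun Ω _ P _ _ r _ E _ _ _ n x => ?_⟩
    simp [min_eq_left h2]
  · obtain ⟨K, hK, h⟩ := exists_eLpNorm_sum_le_mul_eLpNorm_two hq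
    refine ⟨K, hK, fun Ω _ P _ _ r hr E _ _ _ n x => ?_⟩
    rw [min_eq_right h2]
    exact h Ω P r hr E n x

theorem eLpNorm_fin_sum_le_kahaneKhintchineK {E : Type u} [NormedAddCommGroup E]
    [NormedSpace ℝ E] [CompleteSpace E] (hr : IsRademacherFamily Q r) (hq : q ≠ ∞)
    (x : Fin n → E) :
    eLpNorm (fun ω => ∑ j : Fin n, r j ω • x j) q Q ≤
      ENNReal.ofReal (kahaneKhintchineK.{u} q (min q 2)) *
        eLpNorm (fun ω => ∑ j : Fin n, r j ω • x j) (min q 2) Q := by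
  simpa only [Finset.sum_range, Fin.val_injective.extend_apply] using
    hr.eLpNorm_sum_le_kahaneKhintchineK hq n (Function.extend Fin.val x 0)

theorem eLpNorm_fin_sum_le_khintchineB (hr : IsRademacherFamily Q r) (hq : q ≠ ∞)
    (a : Fin n → ℝ) {t : ℝ} (ht : 0 < t) (ht2 : t ≤ 2) :
    eLpNorm (fun ω => ∑ j : Fin n, r j ω * a j) q Q ≤
      ENNReal.ofReal (khintchineB q) * (∑ j, ‖a j‖ₑ ^ t) ^ (1 / t) := by
  have hℓ2 : ENNReal.ofReal (√(∑ j, a j ^ 2)) = (∑ j, ‖a j‖ₑ ^ (2 : ℝ)) ^ (1 / 2 : ℝ) := by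
    rw [Real.sqrt_eq_rpow, ← ENNReal.ofReal_rpow_of_nonneg
      (Finset.sum_nonneg fun _ _ => sq_nonneg _) (by norm_num),
      ENNReal.ofReal_sum_of_nonneg fun _ _ => sq_nonneg _]
    simp only [ENNReal.rpow_ofNat, Real.enorm_eq_ofReal_abs, ← ENNReal.ofReal_pow (abs_nonneg _),
      sq_abs]
  have h := hr.eLpNorm_sum_le_khintchineB hq n (Function.extend Fin.val a 0)
  simp only [Finset.sum_range, Fin.val_injective.extend_apply, hℓ2] at h
  exact h.trans (by gcongr; exact rpow_sum_rpow_anti _ _ ht ht2)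

theorem eLpNorm_prod_fin_sum_le_khintchineB {α : Type*} [MeasurableSpace α] {μ : Measure α}
    (hr : IsRademacherFamily Q r) (hq : q ≠ ∞) {h : Fin n → α → ℝ}
    (hh : ∀ j, StronglyMeasurable (h j)) {t : ℝ} (ht : 0 < t) (ht2 : t ≤ 2)
    (htq : ENNReal.ofReal t ≤ q) :
    eLpNorm (fun z : α × R => ∑ j : Fin n, r j z.2 * h j z.1) q (μ.prod Q) ≤
      ENNReal.ofReal (khintchineB q) * (∑ j, eLpNorm (h j) q μ ^ t) ^ (1 / t) := by
  have hmeas : StronglyMeasurable fun z : α × R => ∑ j : Fin n, r j z.2 * h j z.1 :=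
    Finset.stronglyMeasurable_fun_sum _ fun j _ =>
      ((hr.measurable j).stronglyMeasurable.comp_measurable measurable_snd).mul
        ((hh j).comp_measurable measurable_fst)
  rw [eLpNorm_prod hmeas.aestronglyMeasurable hq]
  calc eLpNorm (fun x => eLpNorm (fun ω => ∑ j : Fin n, r j ω * h j x) q Q) q μ
      ≤ ENNReal.ofReal (khintchineB q) *
          eLpNorm (fun x => (∑ j, ‖h j x‖ₑ ^ t) ^ (1 / t)) q μ :=
        eLpNorm_le_mul_eLpNorm_of_ae_le_mul' (c := (khintchineB q).toNNReal)
          (ae_of_all _ fun x => hr.eLpNorm_fin_sum_le_khintchineB hq (h · x) ht ht2) q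
    _ ≤ _ := by
        gcongr
        exact eLpNorm_rpow_sum_rpow_le _ (fun j => (hh j).aestronglyMeasurable) ht htq

/-- `L^p` has the type of the scalars: by Tonelli the norm of a Rademacher sum in `L^p(Ω; L^p(S))`
is that of a scalar Rademacher sum over `S × Ω`. -/
theorem eLpNorm_fin_sum_Lp_le_khintchineB {α : Type*} [MeasurableSpace α] {μ : Measure α}
    [SFinite μ] [Fact (1 ≤ p)] (hr : IsRademacherFamily Q r) (hp : p ≠ ∞) (y : Fin n → Lp ℝ p μ)
    {t : ℝ} (ht : 0 < t) (ht2 : t ≤ 2) (htp : ENNReal.ofReal t ≤ p) :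
    eLpNorm (fun ω => ∑ j : Fin n, r j ω • y j) p Q ≤
      ENNReal.ofReal (khintchineB p) * (∑ j, ‖y j‖ₑ ^ t) ^ (1 / t) := by
  have hmeas : StronglyMeasurable fun z : α × R => ∑ j : Fin n, r j z.2 * y j z.1 :=
    Finset.stronglyMeasurable_fun_sum _ fun j _ =>
      ((hr.measurable j).stronglyMeasurable.comp_measurable measurable_snd).mul
        ((Lp.stronglyMeasurable (y j)).comp_measurable measurable_fst)
  calc eLpNorm (fun ω => ∑ j : Fin n, r j ω • y j) p Q
      = eLpNorm (fun z : α × R => ∑ j : Fin n, r j z.2 * y j z.1) p (μ.prod Q) := by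
        rw [eLpNorm_prod_symm hmeas.aestronglyMeasurable hp]
        exact eLpNorm_congr_enorm_ae (ae_of_all _ fun ω => by
          rw [enorm_sum_smul_Lp _ fun _ => ae_eq_rfl, enorm_eq_self])
    _ ≤ _ := hr.eLpNorm_prod_fin_sum_le_khintchineB hp (fun j => Lp.stronglyMeasurable (y j)) ht
        ht2 htp
    _ = _ := by simp only [Lp.enorm_def]

end IsRademacherFamily

section Symmetrization

theorem stronglyMeasurable_of_comap_le {α β : Type*} {m m₀ : MeasurableSpace α}
    [TopologicalSpace β] [TopologicalSpace.PseudoMetrizableSpace β] [MeasurableSpace β]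
    [BorelSpace β] {f : α → β} (hf : StronglyMeasurable[m₀] f)
    (hm : MeasurableSpace.comap f inferInstance ≤ m) : StronglyMeasurable[m] f :=
  stronglyMeasurable_iff_measurable_separable.2
    ⟨(comap_measurable f).mono hm le_rfl, hf.isSeparable_range⟩

theorem IsRademacherFamily.aestronglyMeasurable_fin_sum_smul {Ω E : Type*} {R : Type}
    [MeasurableSpace Ω] [MeasurableSpace R] {P : Measure Ω} {Q : Measure R}
    [NormedAddCommGroup E] [NormedSpace ℝ E] {r : ℕ → R → ℝ} (hr : IsRademacherFamily Q r) {n : ℕ}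
    {Y : Fin n → Ω → E} (hY : ∀ j, AEStronglyMeasurable (Y j) P) :
    AEStronglyMeasurable (fun z : Ω × R => ∑ j : Fin n, r j z.2 • Y j z.1) (P.prod Q) :=
  Finset.aestronglyMeasurable_fun_sum _ fun j _ =>
    ((hr.measurable j).comp measurable_snd).aestronglyMeasurable.smul (hY j).comp_fst

variable {Ω : Type*} {mΩ : MeasurableSpace Ω} {P : Measure Ω} [IsProbabilityMeasure P]
  {E : Type*} [NormedAddCommGroup E] [NormedSpace ℝ E] [CompleteSpace E] [MeasurableSpace E]
  [BorelSpace E]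

theorem condExp_iSup_comap_ae_eq_zero {ι : Type*} {Y : ι → Ω → E}
    (hY : ∀ j, StronglyMeasurable (Y j)) (hind : iIndepFun Y P) {j : ι}
    (hj : ∫ ω, Y j ω ∂P = 0) {A : Finset ι} (hjA : j ∉ A) :
    P[Y j | ⨆ i ∈ A, MeasurableSpace.comap (Y i) inferInstance] =ᵐ[P] 0 := by
  have hle (i : ι) := (hY i).measurable.comap_le
  have hindep := indep_iSup_of_disjoint hle hind (S := {j}) (T := A) (by simpa using hjA)
  simp only [Set.mem_singleton_iff, iSup_iSup_eq_left] at hindep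
  filter_upwards [condExp_indep_eq (hle j) (iSup₂_le fun i _ => hle i)
    (stronglyMeasurable_of_comap_le (hY j) le_rfl) hindep] with ω hω
  rw [Pi.zero_apply, ← hj]
  exact hω

/-- Conditioning on the summands that are kept annihilates the other ones, and conditional
expectations are contractions of `L^q`. -/
theorem eLpNorm_sum_subset_le_of_stronglyMeasurable {ι : Type*} {Y : ι → Ω → E}
    (hY : ∀ j, StronglyMeasurable (Y j)) (hint : ∀ j, Integrable (Y j) P)
    (h0 : ∀ j, ∫ ω, Y j ω ∂P = 0) (hind : iIndepFun Y P) {A B : Finset ι} (hAB : A ⊆ B)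
    {q : ℝ≥0∞} (hq : 1 ≤ q) :
    eLpNorm (∑ j ∈ A, Y j) q P ≤ eLpNorm (∑ j ∈ B, Y j) q P := by
  classical
  let m : MeasurableSpace Ω := ⨆ i ∈ A, MeasurableSpace.comap (Y i) inferInstance
  have hm : m ≤ _ := iSup₂_le fun i _ => (hY i).measurable.comap_le
  have hkept (j : ι) (hj : j ∈ A) : P[Y j | m] = Y j :=
    condExp_of_stronglyMeasurable hm
      (stronglyMeasurable_of_comap_le (hY j) (le_iSup₂_of_le j hj le_rfl)) (hint j)
  have hcond : P[∑ j ∈ B, Y j | m] =ᵐ[P] ∑ j ∈ A, Y j := by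
    have hdropped : ∀ᵐ ω ∂P, ∀ j ∈ B \ A, P[Y j | m] ω = 0 :=
      (ae_ball_iff (B \ A).countable_toSet).2 fun j hj =>
        condExp_iSup_comap_ae_eq_zero hY hind (h0 j) (Finset.mem_sdiff.1 hj).2
    filter_upwards [condExp_finsetSum (fun j _ => hint j) m, hdropped] with ω hsum hω
    rw [hsum, ← Finset.sum_sdiff hAB, Pi.add_apply, Finset.sum_apply, Finset.sum_eq_zero hω,
      zero_add, Finset.sum_congr rfl hkept]
  rw [← eLpNorm_congr_ae hcond]
  exact eLpNorm_condExp_le_eLpNorm _ hq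

theorem eLpNorm_sum_subset_le {ι : Type*} [Countable ι] {Y : ι → Ω → E}
    (hint : ∀ j, Integrable (Y j) P) (h0 : ∀ j, ∫ ω, Y j ω ∂P = 0) (hind : iIndepFun Y P)
    {A B : Finset ι} (hAB : A ⊆ B) {q : ℝ≥0∞} (hq : 1 ≤ q) :
    eLpNorm (∑ j ∈ A, Y j) q P ≤ eLpNorm (∑ j ∈ B, Y j) q P := by
  let Z : ι → Ω → E := fun j => (hint j).1.mk (Y j)
  have hZ (j : ι) : Y j =ᵐ[P] Z j := (hint j).1.ae_eq_mk
  have hsum (C : Finset ι) : eLpNorm (∑ j ∈ C, Y j) q P = eLpNorm (∑ j ∈ C, Z j) q P := by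
    refine eLpNorm_congr_ae ?_
    filter_upwards [ae_all_iff.2 hZ] with ω hω
    simp only [Finset.sum_apply, hω]
  rw [hsum, hsum]
  exact eLpNorm_sum_subset_le_of_stronglyMeasurable (fun j => (hint j).1.stronglyMeasurable_mk)
    (fun j => (hint j).congr (hZ j)) (fun j => (integral_congr_ae (hZ j)).symm.trans (h0 j))
    (hind.congr hZ) hAB hq

theorem eLpNorm_sum_le_two_mul_eLpNorm_sum_smul {ι : Type*} [Fintype ι] {Y : ι → Ω → E}
    (hint : ∀ j, Integrable (Y j) P) (h0 : ∀ j, ∫ ω, Y j ω ∂P = 0) (hind : iIndepFun Y P)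
    {ε : ι → ℝ} (hε : ∀ j, ε j = -1 ∨ ε j = 1) {q : ℝ≥0∞} (hq : 1 ≤ q) :
    eLpNorm (∑ j, Y j) q P ≤ 2 * eLpNorm (∑ j, ε j • Y j) q P := by
  classical
  have hint' (j : ι) : Integrable (ε j • Y j) P := (hint j).smul _
  have hdrop (A : Finset ι) :
      eLpNorm (∑ j ∈ A, ε j • Y j) q P ≤ eLpNorm (∑ j, ε j • Y j) q P := by
    refine eLpNorm_sum_subset_le hint' (fun j => ?_)
      (hind.comp (fun j => (ε j • · : E → E)) fun j => measurable_const_smul _)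
      A.subset_univ hq
    simp only [Pi.smul_apply, integral_smul, h0, smul_zero]
  let A : Finset ι := {j | ε j = 1}
  have hsplit : ∑ j, Y j = ∑ j ∈ A, ε j • Y j - ∑ j ∈ Aᶜ, ε j • Y j := by
    rw [← Finset.sum_add_sum_compl A, sub_eq_add_neg, ← Finset.sum_neg_distrib]
    congr 1 <;> refine Finset.sum_congr rfl fun j hj => ?_
    · rw [(Finset.mem_filter.1 hj).2, one_smul]
    · have hj : ε j ≠ 1 := by simpa [A] using hj
      rw [(hε j).resolve_right hj, neg_one_smul, neg_neg]
  have hmeas (A : Finset ι) : AEStronglyMeasurable (∑ j ∈ A, ε j • Y j) P :=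
    (integrable_finsetSum' _ fun j _ => hint' j).1
  calc eLpNorm (∑ j, Y j) q P
      ≤ eLpNorm (∑ j ∈ A, ε j • Y j) q P + eLpNorm (∑ j ∈ Aᶜ, ε j • Y j) q P := by
        rw [hsplit]
        exact eLpNorm_sub_le (hmeas A) (hmeas Aᶜ) hq
    _ ≤ 2 * eLpNorm (∑ j, ε j • Y j) q P := by
        rw [two_mul]
        exact add_le_add (hdrop A) (hdrop Aᶜ)

theorem IsRademacherFamily.eLpNorm_fin_sum_le_two_mul {R : Type} [MeasurableSpace R]
    {Q : Measure R} [IsProbabilityMeasure Q] {r : ℕ → R → ℝ} (hr : IsRademacherFamily Q r)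
    {n : ℕ} {Y : Fin n → Ω → E} (hint : ∀ j, Integrable (Y j) P)
    (h0 : ∀ j, ∫ ω, Y j ω ∂P = 0) (hind : iIndepFun Y P) {q : ℝ≥0∞} (hq : 1 ≤ q) (hq' : q ≠ ∞) :
    eLpNorm (∑ j, Y j) q P ≤
      2 * eLpNorm (fun z : Ω × R => ∑ j : Fin n, r j z.2 • Y j z.1) q (P.prod Q) := by
  have hq0 : q ≠ 0 := (one_pos.trans_le hq).ne'
  rw [eLpNorm_prod_symm (hr.aestronglyMeasurable_fin_sum_smul fun j => (hint j).1) hq']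
  calc eLpNorm (∑ j, Y j) q P = eLpNorm (fun _ : R => eLpNorm (∑ j, Y j) q P) q Q := by
        rw [eLpNorm_const _ hq0 (NeZero.ne Q)]; simp
    _ ≤ 2 * eLpNorm (fun ω' => eLpNorm (fun ω => ∑ j : Fin n, r j ω' • Y j ω) q P) q Q := by
        refine eLpNorm_le_mul_eLpNorm_of_ae_le_mul' (c := 2) (ae_of_all _ fun ω' => ?_) q
        simpa only [enorm_eq_self, Finset.sum_fn, Pi.smul_def] using!
          eLpNorm_sum_le_two_mul_eLpNorm_sum_smul hint h0 hind (fun j : Fin n => hr.values j ω') hq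

end Symmetrization

section JointVersion

variable {S : Type u} {Ω : Type v} [MeasurableSpace S] [MeasurableSpace Ω]

/-- `g` is the jointly measurable version `η̃` of the random variable `η : Ω → L^p(S)`. -/
def IsJointVersion {p : ℝ≥0∞} (μ : Measure S) (P : Measure Ω) (η : Ω → Lp ℝ p μ)
    (g : S × Ω → ℝ) : Prop :=
  Measurable g ∧ ∀ᵐ ω ∂P, η ω =ᵐ[μ] fun s => g (s, ω)

end JointVersion

section MomentBounds

variable {S : Type u} {Ω : Type v} [MeasurableSpace S] [MeasurableSpace Ω] {μ : Measure S}
  [SFinite μ] {P : Measure Ω} [IsProbabilityMeasure P] {p q : ℝ≥0∞} [Fact (1 ≤ p)]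
  [MeasurableSpace (Lp ℝ p μ)] [BorelSpace (Lp ℝ p μ)] {n : ℕ} {Y : Fin n → Ω → Lp ℝ p μ}

theorem eLpNorm_sum_Lp_le_of_le (hp : p ≠ ∞) (hq : 1 ≤ q) (hqp : q ≤ p)
    (hint : ∀ j, Integrable (Y j) P) (h0 : ∀ j, ∫ ω, Y j ω ∂P = 0) (hind : iIndepFun Y P) {t : ℝ}
    (ht : 0 < t) (ht2 : t ≤ 2) (htq : ENNReal.ofReal t ≤ q) :
    eLpNorm (∑ j, Y j) q P ≤
      2 * ENNReal.ofReal (kahaneKhintchineK.{u} q (min q 2)) * ENNReal.ofReal (khintchineB p) *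
        (∑ j, eLpNorm (Y j) q P ^ t) ^ (1 / t) := by
  obtain ⟨R, _, Q, _, _, r, hr⟩ := exists_isRademacherFamily
  have hq' : q ≠ ∞ := ne_top_of_le_ne_top hp hqp
  set K := ENNReal.ofReal (kahaneKhintchineK.{u} q (min q 2))
  set B := ENNReal.ofReal (khintchineB p)
  have hsection (ω : Ω) : eLpNorm (fun ω' => ∑ j : Fin n, r j ω' • Y j ω) q Q ≤
      K * B * (∑ j, ‖Y j ω‖ₑ ^ t) ^ (1 / t) :=
    calc eLpNorm (fun ω' => ∑ j : Fin n, r j ω' • Y j ω) q Q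
        ≤ K * eLpNorm (fun ω' => ∑ j : Fin n, r j ω' • Y j ω) (min q 2) Q :=
          hr.eLpNorm_fin_sum_le_kahaneKhintchineK hq' (Y · ω)
      _ ≤ K * eLpNorm (fun ω' => ∑ j : Fin n, r j ω' • Y j ω) p Q := by
          gcongr
          exact eLpNorm_le_eLpNorm_of_exponent_le ((min_le_left q 2).trans hqp)
            (Finset.aestronglyMeasurable_fun_sum _ fun (j : Fin n) _ =>
              ((hr.measurable j).stronglyMeasurable.smul_const (Y j ω)).aestronglyMeasurable)
      _ ≤ K * (B * (∑ j, ‖Y j ω‖ₑ ^ t) ^ (1 / t)) := by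
          gcongr
          exact hr.eLpNorm_fin_sum_Lp_le_khintchineB hp (Y · ω) ht ht2 (htq.trans hqp)
      _ = _ := (mul_assoc _ _ _).symm
  calc eLpNorm (∑ j, Y j) q P
      ≤ 2 * eLpNorm (fun z : Ω × R => ∑ j : Fin n, r j z.2 • Y j z.1) q (P.prod Q) :=
        hr.eLpNorm_fin_sum_le_two_mul hint h0 hind hq hq'
    _ = 2 * eLpNorm (fun ω => eLpNorm (fun ω' => ∑ j : Fin n, r j ω' • Y j ω) q Q) q P := by
        rw [eLpNorm_prod (hr.aestronglyMeasurable_fin_sum_smul fun j => (hint j).1) hq']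
    _ ≤ 2 * (K * B * eLpNorm (fun ω => (∑ j, ‖Y j ω‖ₑ ^ t) ^ (1 / t)) q P) := by
        gcongr
        exact eLpNorm_le_mul_eLpNorm_of_ae_le_mul'
          (c := (kahaneKhintchineK.{u} q (min q 2)).toNNReal * (khintchineB p).toNNReal)
          (ae_of_all _ fun ω => by simpa only [enorm_eq_self, ENNReal.coe_mul] using! hsection ω) q
    _ ≤ 2 * (K * B * (∑ j, eLpNorm (Y j) q P ^ t) ^ (1 / t)) := by
        gcongr
        exact eLpNorm_rpow_sum_rpow_le _ (fun j => (hint j).1) ht htq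
    _ = _ := by ring

/-- Minkowski's integral inequality moves the integration over `S` to the outside, where only the
scalar Khintchine inequality is needed. -/
theorem eLpNorm_sum_Lp_le_of_ge (hq : q ≠ ∞) (hpq : p ≤ q) (hint : ∀ j, Integrable (Y j) P)
    (h0 : ∀ j, ∫ ω, Y j ω ∂P = 0) (hind : iIndepFun Y P) {g : Fin n → S × Ω → ℝ}
    (hg : ∀ j, IsJointVersion μ P (Y j) (g j)) {t : ℝ} (ht : 0 < t) (ht2 : t ≤ 2)
    (htq : ENNReal.ofReal t ≤ q) :
    eLpNorm (∑ j, Y j) q P ≤ 2 * ENNReal.ofReal (khintchineB q) *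
      eLpNorm (fun s => (∑ j, eLpNorm (fun ω => g j (s, ω)) q P ^ t) ^ (1 / t)) p μ := by
  obtain ⟨R, _, Q, _, _, r, hr⟩ := exists_isRademacherFamily
  have hp1 : 1 ≤ p := Fact.out
  let G : S × (Ω × R) → ℝ := fun w => ∑ j : Fin n, r j w.2.2 * g j (w.1, w.2.1)
  have hG : Measurable G := Finset.measurable_fun_sum _ fun j _ =>
    ((hr.measurable j).comp (measurable_snd.comp measurable_snd)).mul
      ((hg j).1.comp (measurable_fst.prodMk (measurable_fst.comp measurable_snd)))
  have hnorm : ∀ᵐ z ∂P.prod Q,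
      ‖∑ j : Fin n, r j z.2 • Y j z.1‖ₑ = eLpNorm (fun s => G (s, z)) p μ := by
    filter_upwards [Measure.quasiMeasurePreserving_fst.ae (ae_all_iff.2 fun j => (hg j).2)]
      with z hz
    exact enorm_sum_smul_Lp (fun j : Fin n => r j z.2) hz
  calc eLpNorm (∑ j, Y j) q P
      ≤ 2 * eLpNorm (fun z : Ω × R => ∑ j : Fin n, r j z.2 • Y j z.1) q (P.prod Q) :=
        hr.eLpNorm_fin_sum_le_two_mul hint h0 hind (hp1.trans hpq) hq
    _ = 2 * eLpNorm (fun z => eLpNorm (fun s => G (s, z)) p μ) q (P.prod Q) := by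
        exact congrArg (2 * ·) (eLpNorm_congr_enorm_ae
          (hnorm.mono fun z hz => hz.trans (enorm_eq_self _).symm))
    _ ≤ 2 * eLpNorm (fun s => eLpNorm (fun z => G (s, z)) q (P.prod Q)) p μ := by
        gcongr
        exact eLpNorm_eLpNorm_le_eLpNorm_eLpNorm hG hpq hq
    _ ≤ 2 * (ENNReal.ofReal (khintchineB q) *
          eLpNorm (fun s => (∑ j, eLpNorm (fun ω => g j (s, ω)) q P ^ t) ^ (1 / t)) p μ) := by
        gcongr
        refine eLpNorm_le_mul_eLpNorm_of_ae_le_mul' (c := (khintchineB q).toNNReal)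
          (ae_of_all _ fun s => ?_) p
        exact hr.eLpNorm_prod_fin_sum_le_khintchineB hq
          (fun j => ((hg j).1.comp measurable_prodMk_left).stronglyMeasurable) ht ht2 htq
    _ = _ := (mul_assoc _ _ _).symm

end MomentBounds

section JointVersions

variable {S : Type u} {Ω : Type v} [MeasurableSpace S] [MeasurableSpace Ω]
  {μ : Measure S} {P : Measure Ω} {p q : ℝ≥0∞}

/-- By Fatou's lemma this functional is lower semicontinuous. -/
theorem measurable_setLIntegral_enorm_rpow_Lp {E : Type*} [NormedAddCommGroup E] [Fact (1 ≤ p)]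
    [MeasurableSpace (Lp E p μ)] [BorelSpace (Lp E p μ)] (A : Set S) (c : ℝ) :
    Measurable fun f : Lp E p μ => ∫⁻ s in A, ‖f s‖ₑ ^ c ∂μ := by
  refine LowerSemicontinuous.measurable <| lowerSemicontinuous_iff_isClosed_preimage.2 fun b =>
    IsSeqClosed.isClosed fun f f₀ hf hlim => ?_
  obtain ⟨φ, -, hφ⟩ := (tendstoInMeasure_of_tendsto_Lp hlim).exists_seq_tendsto_ae
  have hliminf : ∀ᵐ s ∂μ.restrict A,
      ‖f₀ s‖ₑ ^ c = liminf (fun n => ‖f (φ n) s‖ₑ ^ c) atTop := by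
    filter_upwards [ae_restrict_of_ae hφ] with s hs
    exact ((ENNReal.continuous_rpow_const.tendsto _).comp hs.enorm).liminf_eq.symm
  calc ∫⁻ s in A, ‖f₀ s‖ₑ ^ c ∂μ
      = ∫⁻ s in A, liminf (fun n => ‖f (φ n) s‖ₑ ^ c) atTop ∂μ := lintegral_congr_ae hliminf
    _ ≤ liminf (fun n => ∫⁻ s in A, ‖f (φ n) s‖ₑ ^ c ∂μ) atTop :=
        lintegral_liminf_le fun n => (Lp.stronglyMeasurable (f (φ n))).enorm.pow_const c
    _ ≤ b := liminf_le_of_frequently_le' (Frequently.of_forall fun n => hf (φ n))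

namespace IsJointVersion

theorem sub_const {X : Ω → Lp ℝ p μ} {g : S × Ω → ℝ} (h : IsJointVersion μ P X g)
    (c : Lp ℝ p μ) : IsJointVersion μ P (fun ω => X ω - c) fun z => g z - c z.1 := by
  refine ⟨h.1.sub ((Lp.stronglyMeasurable c).measurable.comp measurable_fst), ?_⟩
  filter_upwards [h.2] with ω hω
  filter_upwards [Lp.coeFn_sub (X ω) c, hω] with s hsub hs
  rw [hsub, Pi.sub_apply, hs]

theorem setLIntegral_lintegral_enorm_rpow [SFinite μ] [SFinite P] {Y : Ω → Lp ℝ p μ}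
    {g : S × Ω → ℝ} (h : IsJointVersion μ P Y g) (A : Set S) (c : ℝ) :
    ∫⁻ s in A, ∫⁻ ω, ‖g (s, ω)‖ₑ ^ c ∂P ∂μ = ∫⁻ ω, ∫⁻ s in A, ‖Y ω s‖ₑ ^ c ∂μ ∂P := by
  rw [lintegral_lintegral_swap (h.1.enorm.pow_const c).aemeasurable]
  refine lintegral_congr_ae ?_
  filter_upwards [h.2] with ω hω
  refine lintegral_congr_ae ?_
  filter_upwards [ae_restrict_of_ae hω] with s hs
  rw [hs]

variable [SigmaFinite μ] [SFinite P] [Fact (1 ≤ p)] [MeasurableSpace (Lp ℝ p μ)]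
  [BorelSpace (Lp ℝ p μ)] {Y Z : Ω → Lp ℝ p μ} {g h : S × Ω → ℝ}

theorem ae_eLpNorm_section_eq (hg : IsJointVersion μ P Y g) (hh : IsJointVersion μ P Z h)
    (hYZ : IdentDistrib Y Z P P) (hq : q ≠ ∞) :
    ∀ᵐ s ∂μ, eLpNorm (fun ω => g (s, ω)) q P = eLpNorm (fun ω => h (s, ω)) q P := by
  rcases eq_or_ne q 0 with rfl | hq0
  · simp
  have hmoments : (fun s => ∫⁻ ω, ‖g (s, ω)‖ₑ ^ q.toReal ∂P) =ᵐ[μ]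
      fun s => ∫⁻ ω, ‖h (s, ω)‖ₑ ^ q.toReal ∂P := by
    refine ae_eq_of_forall_setLIntegral_eq_of_sigmaFinite
      (hg.1.enorm.pow_const _).lintegral_prod_right' (hh.1.enorm.pow_const _).lintegral_prod_right'
      fun A _ _ => ?_
    rw [hg.setLIntegral_lintegral_enorm_rpow, hh.setLIntegral_lintegral_enorm_rpow]
    exact (hYZ.comp (measurable_setLIntegral_enorm_rpow_Lp A q.toReal)).lintegral_eq
  filter_upwards [hmoments] with s hs
  simp only [eLpNorm_eq_lintegral_rpow_enorm_toReal hq0 hq, hs]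

theorem eLpNorm_eLpNorm_section_le_eMixedNorm [Fact (1 ≤ q)] (hg : IsJointVersion μ P Y g)
    (hYZ : IdentDistrib Y Z P P) (hq : q ≠ ∞) :
    eLpNorm (fun s => eLpNorm (fun ω => g (s, ω)) q P) p μ ≤ eMixedNorm q μ P Z := by
  refine le_iInf₂ fun F ⟨_, h, hh, hZh, hFh⟩ => ?_
  refine (eLpNorm_congr_enorm_ae ?_).le
  filter_upwards [hg.ae_eLpNorm_section_eq ⟨hh, hZh⟩ hYZ hq, hFh] with s hgh hF
  rw [enorm_eq_self, hgh, Lp.enorm_def, eLpNorm_congr_ae hF]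

end IsJointVersion

namespace MemMixed

variable [Fact (1 ≤ q)] {X : Ω → Lp ℝ p μ}

theorem exists_isJointVersion (hX : MemMixed q μ P X) : ∃ g, IsJointVersion μ P X g :=
  let ⟨_, ⟨_, g, hg, hXg, _⟩, _⟩ := hX
  ⟨g, hg, hXg⟩

theorem eMixedNorm_ne_top (hX : MemMixed q μ P X) : eMixedNorm q μ P X ≠ ∞ :=
  let ⟨F, hF, hFp⟩ := hX
  ne_top_of_le_ne_top hFp.eLpNorm_ne_top (iInf₂_le F hF)

theorem sub_const [IsFiniteMeasure P] (hX : MemMixed q μ P X) (c : Lp ℝ p μ) :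
    MemMixed q μ P fun ω => X ω - c := by
  obtain ⟨F, ⟨-, g, hg, hXg, hFg⟩, hFp⟩ := hX
  have hFc : MemLp (fun s => F s - Lp.constL q P ℝ (c s)) p μ :=
    hFp.sub ((Lp.constL q P ℝ : ℝ →L[ℝ] Lp ℝ q P).comp_memLp' (Lp.memLp c))
  obtain ⟨hgc, hXgc⟩ := IsJointVersion.sub_const ⟨hg, hXg⟩ c
  refine ⟨_, ⟨hFc.1, _, hgc, hXgc, ?_⟩, hFc⟩
  filter_upwards [hFg] with s hs
  have hconst : Lp.constL q P ℝ (c s) =ᵐ[P] Function.const Ω (c s) := Lp.coeFn_const q P (c s)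
  filter_upwards [Lp.coeFn_sub (F s) (Lp.constL q P ℝ (c s)), hs, hconst] with ω hsub hF hconst
  rw [hsub, Pi.sub_apply, hF, hconst, Function.const_apply]

end MemMixed

end JointVersions

section MonteCarlo

variable {S : Type u} {Ω : Type v} [MeasurableSpace S] [MeasurableSpace Ω]
  {μ : Measure S} {P : Measure Ω} {p q : ℝ≥0∞} [Fact (1 ≤ p)]

theorem constSL_nonneg [Fact (1 ≤ q)] (X : Ω → Lp ℝ p μ) : 0 ≤ constSL q μ P X := by
  have hBp := khintchineB_nonneg p
  have hBq := khintchineB_nonneg q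
  have hK := kahaneKhintchineK_nonneg.{u} q (min q 2)
  rw [constSL]
  split_ifs <;> positivity

theorem ofReal_constSL_of_lt [IsFiniteMeasure P] [Fact (1 ≤ q)] {X : Ω → Lp ℝ p μ}
    (hX : MemLp X q P) (hqp : q < p) :
    ENNReal.ofReal (constSL q μ P X) =
      2 * ENNReal.ofReal (kahaneKhintchineK.{u} q (min q 2)) * ENNReal.ofReal (khintchineB p) *
        eLpNorm (fun ω => X ω - ∫ ω', X ω' ∂P) q P := by
  have hB := khintchineB_nonneg p
  have hK := kahaneKhintchineK_nonneg.{u} q (min q 2)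
  have hXc : MemLp (fun ω => X ω - ∫ ω', X ω' ∂P) q P := hX.sub (memLp_const _)
  rw [constSL, if_pos hqp, ENNReal.ofReal_mul (by positivity), ENNReal.ofReal_mul (by positivity),
    ENNReal.ofReal_mul zero_le_two, ENNReal.ofReal_ofNat,
    ENNReal.ofReal_toReal hXc.eLpNorm_ne_top]

theorem ofReal_constSL_of_ge [IsFiniteMeasure P] [Fact (1 ≤ q)] {X : Ω → Lp ℝ p μ}
    (hX : MemMixed q μ P X) (hpq : p ≤ q) :
    ENNReal.ofReal (constSL q μ P X) = 2 * ENNReal.ofReal (khintchineB q) *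
      eMixedNorm q μ P (fun ω => X ω - ∫ ω', X ω' ∂P) := by
  have hB := khintchineB_nonneg q
  rw [constSL, if_neg hpq.not_gt, ENNReal.ofReal_mul (by positivity),
    ENNReal.ofReal_mul zero_le_two, ENNReal.ofReal_ofNat,
    ENNReal.ofReal_toReal (hX.sub_const _).eMixedNorm_ne_top]

theorem sub_average_eq_sub_sub_average {E : Type*} [AddCommGroup E] [Module ℝ E] {n : ℕ} [NeZero n]
    (u c : E) (x : Fin n → E) :
    u - (n : ℝ)⁻¹ • ∑ j, x j = u - c - (n : ℝ)⁻¹ • ∑ j, (x j - c) := by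
  rw [Finset.sum_sub_distrib, Finset.sum_const, Finset.card_univ, Fintype.card_fin, smul_sub,
    ← Nat.cast_smul_eq_nsmul ℝ n c, inv_smul_smul₀ (NeZero.ne (n : ℝ))]
  abel

theorem sum_const_rpow_rpow_one_div (n : ℕ) (a : ℝ≥0∞) {t : ℝ} (ht : 0 < t) :
    (∑ _j : Fin n, a ^ t) ^ (1 / t) = (n : ℝ≥0∞) ^ (1 / t) * a := by
  rw [Finset.sum_const, Finset.card_univ, Fintype.card_fin, nsmul_eq_mul,
    ENNReal.mul_rpow_of_nonneg _ _ (by positivity), one_div, ENNReal.rpow_rpow_inv ht.ne']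

variable [IsProbabilityMeasure P] [MeasurableSpace (Lp ℝ p μ)] [BorelSpace (Lp ℝ p μ)] {n : ℕ}
  [NeZero n]

theorem eLpNorm_sum_Lp_le_of_le_of_identDistrib [SFinite μ] {Y : Fin n → Ω → Lp ℝ p μ}
    (hp : p ≠ ∞) (hq : 1 ≤ q) (hqp : q ≤ p)
    (hint : ∀ j, Integrable (Y j) P) (h0 : ∀ j, ∫ ω, Y j ω ∂P = 0) (hind : iIndepFun Y P)
    (hid : ∀ j, IdentDistrib (Y j) (Y 0) P P) {t : ℝ} (ht : 0 < t) (ht2 : t ≤ 2)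
    (htq : ENNReal.ofReal t ≤ q) :
    eLpNorm (∑ j, Y j) q P ≤
      2 * ENNReal.ofReal (kahaneKhintchineK.{u} q (min q 2)) * ENNReal.ofReal (khintchineB p) *
        ((n : ℝ≥0∞) ^ (1 / t) * eLpNorm (Y 0) q P) := by
  simpa only [fun j => (hid j).eLpNorm_eq q, sum_const_rpow_rpow_one_div _ _ ht] using
    eLpNorm_sum_Lp_le_of_le hp hq hqp hint h0 hind ht ht2 htq

theorem eLpNorm_sum_Lp_le_of_ge_of_identDistrib [SigmaFinite μ] [Fact (1 ≤ q)]
    {Y : Fin n → Ω → Lp ℝ p μ} (hq : q ≠ ∞)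
    (hpq : p ≤ q) (hint : ∀ j, Integrable (Y j) P) (h0 : ∀ j, ∫ ω, Y j ω ∂P = 0)
    (hind : iIndepFun Y P) (hid : ∀ j, IdentDistrib (Y j) (Y 0) P P)
    (hY : ∀ j, ∃ g, IsJointVersion μ P (Y j) g) {t : ℝ} (ht : 0 < t)
    (ht2 : t ≤ 2) (htq : ENNReal.ofReal t ≤ q) :
    eLpNorm (∑ j, Y j) q P ≤ 2 * ENNReal.ofReal (khintchineB q) *
      ((n : ℝ≥0∞) ^ (1 / t) * eMixedNorm q μ P (Y 0)) := by
  choose g hg using hY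
  have hsections : ∀ᵐ s ∂μ,
      ‖(∑ j, eLpNorm (fun ω => g j (s, ω)) q P ^ t) ^ (1 / t)‖ₑ ≤
        ((n : NNReal) ^ (1 / t) : NNReal) * ‖eLpNorm (fun ω => g 0 (s, ω)) q P‖ₑ := by
    filter_upwards [ae_all_iff.2 fun j => (hg j).ae_eLpNorm_section_eq (hg 0) (hid j) hq] with s hs
    simp only [hs, sum_const_rpow_rpow_one_div _ _ ht, enorm_eq_self,
      ENNReal.coe_rpow_of_nonneg _ (one_div_nonneg.2 ht.le), ENNReal.coe_natCast, le_refl]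
  calc eLpNorm (∑ j, Y j) q P
      ≤ 2 * ENNReal.ofReal (khintchineB q) *
          eLpNorm (fun s => (∑ j, eLpNorm (fun ω => g j (s, ω)) q P ^ t) ^ (1 / t)) p μ :=
        eLpNorm_sum_Lp_le_of_ge hq hpq hint h0 hind hg ht ht2 htq
    _ ≤ 2 * ENNReal.ofReal (khintchineB q) * ((n : ℝ≥0∞) ^ (1 / t) *
          eLpNorm (fun s => eLpNorm (fun ω => g 0 (s, ω)) q P) p μ) := by
        gcongr
        rw [← ENNReal.coe_natCast, ← ENNReal.coe_rpow_of_nonneg _ (one_div_nonneg.2 ht.le)]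
        exact eLpNorm_le_mul_eLpNorm_of_ae_le_mul' hsections p
    _ ≤ _ := by
        gcongr
        exact (hg 0).eLpNorm_eLpNorm_section_le_eMixedNorm (hid 0) hq

theorem eLpNorm_sum_sub_integral_le [SigmaFinite μ] [Fact (1 ≤ q)] {X : Fin n → Ω → Lp ℝ p μ}
    (hp : p ≠ ∞) (hq : q ≠ ∞) (hX : MemLp (X 0) q P)
    (hmix : p ≤ q → ∀ j, MemMixed q μ P (X j)) (hind : iIndepFun X P)
    (hid : ∀ j, IdentDistrib (X j) (X 0) P P) :
    eLpNorm (∑ j, fun ω => X j ω - ∫ ω', X 0 ω' ∂P) q P ≤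
      (n : ℝ≥0∞) ^ (1 / (min q 2).toReal) * ENNReal.ofReal (constSL q μ P (X 0)) := by
  have hq1 : 1 ≤ q := Fact.out
  set c : Lp ℝ p μ := ∫ ω', X 0 ω' ∂P with hc
  have hmin : min q 2 ≠ ∞ := ne_top_of_le_ne_top hq (min_le_left _ _)
  have ht : 0 < (min q 2).toReal :=
    ENNReal.toReal_pos (one_pos.trans_le (le_min hq1 one_le_two)).ne' hmin
  have ht2 : (min q 2).toReal ≤ 2 :=
    ENNReal.toReal_mono (b := 2) ENNReal.ofNat_ne_top (min_le_right _ _)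
  have htq : ENNReal.ofReal (min q 2).toReal ≤ q :=
    (ENNReal.ofReal_toReal hmin).trans_le (min_le_left _ _)
  have hint (j : Fin n) : Integrable (X j) P := (hid j).integrable_iff.2 (hX.integrable hq1)
  have hsub : Measurable fun f : Lp ℝ p μ => f - c :=
    (continuous_id.sub continuous_const).measurable
  have hintc (j : Fin n) : Integrable (fun ω => X j ω - c) P := (hint j).sub (integrable_const c)
  have h0 (j : Fin n) : ∫ ω, (X j ω - c) ∂P = 0 := by
    rw [integral_sub (hint j) (integrable_const c), (hid j).integral_eq, integral_const,
      probReal_univ, one_smul, hc, sub_self]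
  have hindc : iIndepFun (fun j ω => X j ω - c) P := hind.comp (fun _ f => f - c) fun _ => hsub
  have hidc (j : Fin n) : IdentDistrib (fun ω => X j ω - c) (fun ω => X 0 ω - c) P P :=
    (hid j).comp hsub
  rcases lt_or_ge q p with hqp | hpq
  · rw [ofReal_constSL_of_lt hX hqp, mul_left_comm]
    exact eLpNorm_sum_Lp_le_of_le_of_identDistrib hp hq1 hqp.le hintc h0 hindc hidc ht ht2 htq
  · rw [ofReal_constSL_of_ge (hmix hpq 0) hpq, mul_left_comm]
    exact eLpNorm_sum_Lp_le_of_ge_of_identDistrib hq hpq hintc h0 hindc hidc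
      (fun j => ((hmix hpq j).sub_const c).exists_isJointVersion) ht ht2 htq

theorem eLpNorm_sub_average_le [SigmaFinite μ] [Fact (1 ≤ q)] {X : Fin n → Ω → Lp ℝ p μ}
    (hp : p ≠ ∞) (hq : q ≠ ∞) (hX : MemLp (X 0) q P)
    (hmix : p ≤ q → ∀ j, MemMixed q μ P (X j)) (hind : iIndepFun X P)
    (hid : ∀ j, IdentDistrib (X j) (X 0) P P) (U : Lp ℝ p μ) :
    eLpNorm (fun ω => U - (n : ℝ)⁻¹ • ∑ j, X j ω) q P ≤
      ENNReal.ofReal (‖U - ∫ ω, X 0 ω ∂P‖ +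
        (n : ℝ) ^ (-(1 - 1 / (min q 2).toReal)) * constSL q μ P (X 0)) := by
  have hn : (0 : ℝ) < n := Nat.cast_pos.2 (NeZero.pos n)
  have hq1 : 1 ≤ q := Fact.out
  set t := (min q 2).toReal
  set c : Lp ℝ p μ := ∫ ω', X 0 ω' ∂P
  have hC := constSL_nonneg (q := q) (P := P) (X 0)
  have hsplit : (fun ω => U - (n : ℝ)⁻¹ • ∑ j, X j ω) =
      (fun _ => U - c) - (n : ℝ)⁻¹ • ∑ j, fun ω => X j ω - c := by
    funext ω
    simp only [sub_average_eq_sub_sub_average U c, Pi.sub_apply, Pi.smul_apply, Finset.sum_apply]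
  have hmeas : AEStronglyMeasurable (∑ j, fun ω => X j ω - c) P :=
    Finset.aestronglyMeasurable_sum _ fun j _ =>
      ((hid j).aestronglyMeasurable_iff.2 hX.1).sub aestronglyMeasurable_const
  have hrate : (n : ℝ)⁻¹ * (n : ℝ) ^ (1 / t) = (n : ℝ) ^ (-(1 - 1 / t)) := by
    rw [← Real.rpow_neg_one, ← Real.rpow_add hn]
    ring_nf
  calc eLpNorm (fun ω => U - (n : ℝ)⁻¹ • ∑ j, X j ω) q P
      ≤ eLpNorm (fun _ => U - c) q P +
          eLpNorm ((n : ℝ)⁻¹ • ∑ j, fun ω => X j ω - c) q P := by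
        rw [hsplit]
        exact eLpNorm_sub_le aestronglyMeasurable_const (hmeas.const_smul _) hq1
    _ ≤ ENNReal.ofReal ‖U - c‖ +
          ENNReal.ofReal (n : ℝ)⁻¹ *
            ((n : ℝ≥0∞) ^ (1 / t) * ENNReal.ofReal (constSL q μ P (X 0))) := by
        rw [eLpNorm_const _ (one_pos.trans_le hq1).ne' (NeZero.ne P), measure_univ,
          ENNReal.one_rpow, mul_one, ofReal_norm, eLpNorm_const_smul,
          Real.enorm_eq_ofReal (by positivity)]
        gcongr
        exact eLpNorm_sum_sub_integral_le hp hq hX hmix hind hid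
    _ = _ := by
        rw [ENNReal.ofReal_add (norm_nonneg _) (by positivity), ← hrate, mul_assoc,
          ENNReal.ofReal_mul (by positivity), ENNReal.ofReal_mul (by positivity),
          ← ENNReal.ofReal_rpow_of_pos hn, ENNReal.ofReal_natCast]

end MonteCarlo

theorem mainTheorem2_general {S : Type u} {Ω : Type v} [MeasurableSpace S] [MeasurableSpace Ω]
    (μ : Measure S) [SigmaFinite μ] (P : Measure Ω) [IsProbabilityMeasure P] :
    (∀ (p q : ℝ≥0∞) [Fact (1 ≤ p)] [Fact (1 ≤ q)], p ≠ ∞ → q ≠ ∞ →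
      ∀ [MeasurableSpace (Lp ℝ p μ)] [BorelSpace (Lp ℝ p μ)]
        (M : ℕ) [NeZero M] (X : Fin M → Ω → Lp ℝ p μ),
        MemLp (X 0) q P → (p ≤ q → ∀ j, MemMixed q μ P (X j)) →
        iIndepFun X P → (∀ j, IdentDistrib (X j) (X 0) P P) →
        ∀ U : Lp ℝ p μ,
          eLpNorm (fun ω => U - (M : ℝ)⁻¹ • ∑ j, X j ω) q P ≤
            ENNReal.ofReal (‖U - ∫ ω, X 0 ω ∂P‖ +
              (M : ℝ) ^ (-(1 - 1 / (min q 2).toReal)) * constSL q μ P (X 0))) ∧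
    (∀ (p q : ℝ≥0∞) [Fact (1 ≤ p)], 1 ≤ q → q ≠ ∞ →
      ∀ [MeasurableSpace (Lp ℝ p μ)] [BorelSpace (Lp ℝ p μ)] (X : ℕ → Ω → Lp ℝ p μ),
        MemLp (X 0) q P → Pairwise (fun i j => IndepFun (X i) (X j) P) →
        (∀ j, IdentDistrib (X j) (X 0) P P) →
        Tendsto (fun M : ℕ => eLpNorm
            (fun ω => (∫ ω', X 0 ω' ∂P) - (M : ℝ)⁻¹ • ∑ j ∈ Finset.range M, X j ω) q P)
          atTop (𝓝 0)) := by
  refine ⟨fun p q _ _ hp hq _ _ M _ X hX hmix hind hid U =>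
    eLpNorm_sub_average_le hp hq hX hmix hind hid U, fun p q _ hq1 hq _ _ X hX hind hid => ?_⟩
  exact (strong_law_Lp hq1 hq X hX hind hid).congr fun M => eLpNorm_sub_comm _ _ q P

theorem mainTheorem2 {S : Type u} {Ω : Type v} [MeasurableSpace S] [MeasurableSpace Ω]
    (μ : Measure S) [SigmaFinite μ] (P : Measure Ω) [IsProbabilityMeasure P]
    (hS : ApproximationByAveraging.{u, v} μ) :
    -- the error bound
    (∀ (p q : ℝ≥0∞) [Fact (1 ≤ p)] [Fact (1 ≤ q)], p ≠ ∞ → q ≠ ∞ →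
      ∀ [MeasurableSpace (Lp ℝ p μ)] [BorelSpace (Lp ℝ p μ)]
        (M : ℕ) [NeZero M] (X : Fin M → Ω → Lp ℝ p μ),
        (∀ j, MemLp (X j) q P) → (∀ j, MemMixed q μ P (X j)) →
        iIndepFun X P → (∀ j, IdentDistrib (X j) (X 0) P P) →
        ∀ U : Lp ℝ p μ,
          eLpNorm (fun ω => U - (M : ℝ)⁻¹ • ∑ j, X j ω) q P ≤
            ENNReal.ofReal (‖U - ∫ ω, X 0 ω ∂P‖ +
              (M : ℝ) ^ (-(1 - 1 / (min q 2).toReal)) * constSL q μ P (X 0))) ∧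
    -- convergence of the Monte Carlo method for random variables with values in `L^1(S)`
    (∀ (q : ℝ≥0∞) [Fact (1 ≤ q)], 1 < q → q ≠ ∞ →
      ∀ [MeasurableSpace (Lp ℝ 1 μ)] [BorelSpace (Lp ℝ 1 μ)] (X : ℕ → Ω → Lp ℝ 1 μ),
        (∀ j, MemLp (X j) q P) → (∀ j, MemMixed q μ P (X j)) →
        iIndepFun X P → (∀ j, IdentDistrib (X j) (X 0) P P) →
        Tendsto (fun M : ℕ => eLpNorm
            (fun ω => (∫ ω', X 0 ω' ∂P) - (M : ℝ)⁻¹ • ∑ j ∈ Finset.range M, X j ω) q P)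
          atTop (𝓝 0)) := by
  have h := mainTheorem2_general μ P
  exact ⟨fun p q _ _ hp hq _ _ M _ X hX hmix => h.1 p q hp hq M X (hX 0) fun _ => hmix,
    fun q _ hq1 hq _ _ X hX _ hind => h.2 1 q hq1.le hq X (hX 0) fun _ _ => hind.indepFun⟩
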